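/- For $n,d\ge 1$ observe $(Y_i,X^i)_{i\le n}$ with $Y_i=\mathrm{tr}(X^i\theta)+\epsilon_i$, where the entries of the $d\times d$ matrices $X^i$ and the noise variables $\epsilon_i$ are all i.i.d. $N(0,1)$ and $\theta\in\mathbb R^{d\times d}$ is unknown; $\mathbb P_\theta$ denotes the joint law of $(Y,X)$. Let $\|\cdot\|$ be either the Frobenius norm $\|\cdot\|_F$ or the nuclear norm $\|\cdot\|_*$ (the sum of the singular values). For $1\le k\le d$ and $\rho>0$ consider testing $H_0:\theta=0$ against $H_1=H_1(k,\rho):\ \mathrm{rank}(\theta)\le k,\ \|\theta\|\ge\rho$. A test is a measurable $\{0,1\}$-valued function $\Psi$ of $(Y,X)$, and its total error is $$\mathcal E(\Psi)=\mathbb P_0(\Psi=1)+\sup_{\theta\in H_1}\mathbb P_\theta(\Psi=0).$$ Define $r=r_{n,d,k}=\min(\sqrt{d/n},\,n^{-1/4})$ in the Frobenius case and $r=\min(\sqrt{kd/n},\,\sqrt k\,n^{-1/4})$ in the nuclear case. **Part 1.** For every $\alpha>0$ there are constants $c\in\mathbb R$, $D>0$ and $n_0\in\mathbb N$, depending only on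 $\alpha$ and the choice of norm, such that for all $n\ge n_0$, all $1\le k\le d$ and all $\rho\ge D\,r_{n,d,k}$ the following test $\Psi$ satisfies $\mathcal E(\Psi)\le\alpha$: if $n<d^2$, $\Psi=1$ if and only if $\frac1n\sum_{i}Y_i^2-1\ge c\,n^{-1/2}$; if $n\ge d^2$, $\Psi=1$ if and only if $$\frac{2}{n(n-1)}\sum_{i<j}\sum_{m,l\le d}Y_iX^i_{ml}\,Y_jX^j_{ml}\ \ge\ c\,\frac dn .$$ **Part 2.** Let $k=k_{n,d}\in\{1,\dots,d\}$ and $\rho=\rho_{n,d}>0$ satisfy $\rho_{n,d}=o(r_{n,d,k})$ and $k_{n,d}=o(d)$ as $\min(n,d)\to\infty$. Then it is not the case that for every $\alpha>0$ there are tests $\Psi_{n,d}$ with $\mathcal E(\Psi_{n,d})\le\alpha$ for all sufficiently large $\min(n,d)$. In fact $$\liminf_{\min(n,d)\to\infty}\ \inf_{\Psi}\ \mathcal E(\Psi)\ \ge\ 1,$$ where the infimum extends over all tests $\Psi=\Psi(Y,X)$. -/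

import Mathlib

open MeasureTheory ProbabilityTheory Filter Asymptotics

open scoped ENNReal

namespace TraceRegression

noncomputable section

/-- The two norms on `d × d` real matrices in which the alternatives may be separated. -/
inductive NormKind
  | frobenius
  | nuclear

/-- Frobenius norm `√(tr(MᵀM))`. -/
def frobeniusNorm {d : ℕ} (M : Matrix (Fin d) (Fin d) ℝ) : ℝ :=
  √((M.transpose * M).trace)

/-- Nuclear norm: the sum of the square roots of the eigenvalues (with multiplicity) of `MᵀM`.
For real matrices the conjugate transpose is the transpose. -/
def nuclearNorm {d : ℕ} (M : Matrix (Fin d) (Fin d) ℝ) : ℝ :=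
  ∑ j : Fin d, √((Matrix.isHermitian_conjTranspose_mul_self M).eigenvalues j)

/-- The norm of the given kind. -/
def NormKind.eval (N : NormKind) {d : ℕ} (M : Matrix (Fin d) (Fin d) ℝ) : ℝ :=
  match N with
  | .frobenius => frobeniusNorm M
  | .nuclear => nuclearNorm M

/-- The detection boundary. -/
def NormKind.rate (N : NormKind) (n d k : ℕ) : ℝ :=
  match N with
  | .frobenius => min (√((d : ℝ) / n)) ((n : ℝ) ^ (-(1 / 4) : ℝ))
  | .nuclear => min (√((k : ℝ) * d / n)) (√(k : ℝ) / (n : ℝ) ^ (1 / 4 : ℝ))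

/-- Designs: `n` real `d × d` arrays `X i`, with entries `X i m l`. -/
abbrev Design (n d : ℕ) : Type := Fin n → Fin d → Fin d → ℝ

/-- Observations `(Y, X)`. -/
abbrev Observation (n d : ℕ) : Type := (Fin n → ℝ) × Design n d

/-- The law of the design: all entries are i.i.d. standard Gaussian. -/
def designLaw (n d : ℕ) : Measure (Design n d) :=
  Measure.pi fun _ => Measure.pi fun _ => Measure.pi fun _ => gaussianReal 0 1

/-- The law of the noise vector: i.i.d. standard Gaussian coordinates. -/
def noiseLaw (n : ℕ) : Measure (Fin n → ℝ) :=
  Measure.pi fun _ => gaussianReal 0 1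

/-- The sampling operator `θ ↦ (tr(X¹θ), …, tr(Xⁿθ))`. -/
def sampling {n d : ℕ} (X : Design n d) (θ : Matrix (Fin d) (Fin d) ℝ) (i : Fin n) : ℝ :=
  (Matrix.of (X i) * θ).trace

/-- The observation `(Y, X)` with `Y i = tr(X i * θ) + ε i`, as a function of `(X, ε)`. -/
def observe {n d : ℕ} (θ : Matrix (Fin d) (Fin d) ℝ) (p : Design n d × (Fin n → ℝ)) :
    Observation n d :=
  (fun i => sampling p.1 θ i + p.2 i, p.1)

/-- The joint law of `(Y, X)` under the parameter `θ`; the noise is independent of the design. -/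
def law (n : ℕ) {d : ℕ} (θ : Matrix (Fin d) (Fin d) ℝ) : Measure (Observation n d) :=
  ((designLaw n d).prod (noiseLaw n)).map (observe θ)

instance (n d : ℕ) : IsProbabilityMeasure (designLaw n d) := by
  unfold designLaw; infer_instance

instance (n : ℕ) : IsProbabilityMeasure (noiseLaw n) := by
  unfold noiseLaw; infer_instance

theorem measurable_observe {n d : ℕ} (θ : Matrix (Fin d) (Fin d) ℝ) :
    Measurable (observe (n := n) θ) := by
  unfold observe sampling
  simp only [Matrix.trace, Matrix.diag, Matrix.mul_apply, Matrix.of_apply]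
  fun_prop

instance {n d : ℕ} (θ : Matrix (Fin d) (Fin d) ℝ) : IsProbabilityMeasure (law n θ) :=
  Measure.isProbabilityMeasure_map (measurable_observe θ).aemeasurable

/-- The alternative hypothesis: matrices of rank at most `k` with norm at least `ρ`. -/
def alternative (N : NormKind) (d k : ℕ) (ρ : ℝ) : Set (Matrix (Fin d) (Fin d) ℝ) :=
  {θ | θ.rank ≤ k ∧ ρ ≤ N.eval θ}

/-- The sum of the type-one error and the worst-case type-two error of the test `1_A` with
rejection region `A`. -/
def testRisk (N : NormKind) {n d : ℕ} (k : ℕ) (ρ : ℝ) (A : Set (Observation n d)) : ℝ≥0∞ :=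
  law n (0 : Matrix (Fin d) (Fin d) ℝ) A + ⨆ θ ∈ alternative N d k ρ, law n θ Aᶜ

/-- The infimum of `testRisk` over all tests, i.e. over all measurable rejection regions. -/
def minimaxRisk (N : NormKind) (n d k : ℕ) (ρ : ℝ) : ℝ≥0∞ :=
  ⨅ (A : Set (Observation n d)) (_ : MeasurableSet A), testRisk N k ρ A

/-- The chi-square statistic `‖Y‖² / n - 1`. -/
def chiSquareStat {n d : ℕ} (z : Observation n d) : ℝ :=
  (1 / (n : ℝ)) * ∑ i, z.1 i ^ 2 - 1

/-- The U-statistic `2 / (n (n - 1)) * ∑_{i < j} ∑_{m, l} Y i * X i m l * Y j * X j m l`. -/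
def uStat {n d : ℕ} (z : Observation n d) : ℝ :=
  (2 / ((n : ℝ) * ((n : ℝ) - 1))) *
    ∑ i : Fin n, ∑ j ∈ Finset.Ioi i, ∑ m : Fin d, ∑ l : Fin d,
      z.1 i * z.2 i m l * (z.1 j * z.2 j m l)

/-- The rejection region of the explicit test with threshold constant `c`: reject when the
chi-square statistic is at least `c / √n` if `n < d²`, and when the U-statistic is at least
`c * d / n` if `n ≥ d²`. -/
def explicitTest (n d : ℕ) (c : ℝ) : Set (Observation n d) :=
  if n < d ^ 2 then {z | c * (1 / √(n : ℝ)) ≤ chiSquareStat z}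
  else {z | c * ((d : ℝ) / n) ≤ uStat z}

end

end TraceRegression

/-!
The sample is a vector of `n` independent rows `(x, ε)`, each a standard Gaussian vector
(`isStdGaussian_rowCoord`), and everything reduces to moments of linear forms in one row. Write
`s = ‖θ‖_F²`.

*Upper bound.* A matrix of rank at most `k` satisfies `‖θ‖_* ≤ √k ‖θ‖_F` (`nuclearNorm_sq_le`), so
for both norms the alternative gives `s ≥ D² min (d / n, n^{-1/2})`. Both statistics have mean `s`.
The chi-square statistic has variance `2 (1 + s)² / n` (`chiSquareStat_second_moment`). For the
U-statistic, Hoeffding's decomposition (`uStat_decomposition`) splits the deviation from `s` into a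
linear part and a degenerate part with pairwise orthogonal summands (`integral_degenerate_sq`), and
the covariance `(1 + s) I + θ θᵀ` of the vectors `Y X`, computed with Isserlis' theorem, bounds the
variance by a multiple of `(1 + s)² d² / n² + (s + s²) / n` (`uStat_second_moment`). Chebyshev's
inequality then controls both errors.

*Lower bound.* Le Cam's method with a prior on `θ = a diag(u) H diag(v)`, where `u`, `v` are uniform
sign vectors and `H` is a fixed sign matrix of rank at most `k`. All these matrices share their rank
and singular values, and `⟨θ, θ'⟩ = a² ⟨u, u'⟩ ⟨v, v'⟩` whatever `H` is. The matrix `H` repeats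
periodically the rows of a `k × d` sign matrix with nearly orthogonal rows (`exists_sign_vectors`).
This keeps `tr (HᵀH)²` of order `d⁴ / k`, and the interpolation inequality
`‖θ‖_F⁶ ≤ ‖θ‖_*² tr (θᵀθ)²` (`frobSq_pow_three_le`) yields `‖H‖_* ≥ d √(k / 8)`, so that one prior
serves both norms. The second moment of the mixture likelihood ratio is at most the average of
`exp (n ⟨θ, θ'⟩ + 4 n s²)` (`likelihood_second_moment`); the average over the signs is at most
`(1 - (n s / d)²)^{-1/2}` (`sum_exp_signInner_mul_le`). Below the boundary `n s²` and `n s / d` tend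
to zero, so the second moment tends to one and no test does asymptotically better than guessing.
-/

namespace TraceRegression

/-! ### The standard Gaussian law -/

noncomputable section

/-- The fourth derivative at `0` of the moment generating function `exp (t² / 2)`. -/
theorem integral_pow_four_gaussianReal : ∫ x, x ^ 4 ∂(gaussianReal 0 1) = 3 := by
  have h0 : (0 : ℝ) ∈ interior (integrableExpSet id (gaussianReal 0 1)) := by
    rw [integrableExpSet_id_gaussianReal]; simp
  have h := iteratedDeriv_mgf_zero h0 4
  simp only [id, Pi.pow_apply] at h
  rw [← h]
  have hd (p q : ℝ → ℝ) (hp : ∀ t, HasDerivAt p (q t - t * p t) t) :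
      deriv (fun t => p t * Real.exp (t ^ 2 / 2)) = fun t => q t * Real.exp (t ^ 2 / 2) := by
    ext t
    have h1 : HasDerivAt (fun t : ℝ => t ^ 2 / 2) t t := by
      simpa using ((hasDerivAt_pow 2 t).div_const 2)
    rw [((hp t).fun_mul h1.exp).deriv]; ring
  have e0 : mgf id (gaussianReal 0 1) = fun t => (fun _ => 1) t * Real.exp (t ^ 2 / 2) := by
    rw [mgf_id_gaussianReal]; simp
  have e1 := hd (fun _ => 1) (fun t => t) (fun t => by simpa using hasDerivAt_const t (1 : ℝ))
  have e2 := hd (fun t => t) (fun t => 1 + t ^ 2)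
    (fun t => (hasDerivAt_id' t).congr_deriv (by ring))
  have e3 := hd (fun t => 1 + t ^ 2) (fun t => 3 * t + t ^ 3)
    (fun t => ((hasDerivAt_pow 2 t).const_add 1).congr_deriv (by simp; ring))
  have e4 := hd (fun t => 3 * t + t ^ 3) (fun t => 3 + 6 * t ^ 2 + t ^ 4)
    (fun t => (((hasDerivAt_id' t).const_mul 3).fun_add (hasDerivAt_pow 3 t)).congr_deriv
      (by simp; ring))
  rw [iteratedDeriv_eq_iterate, e0]
  simp only [Function.iterate_succ, Function.comp_apply, Function.iterate_zero, id]
  rw [e1, e2, e3, e4]; simp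

theorem integral_sq_gaussianReal : ∫ x, x ^ 2 ∂(gaussianReal 0 1) = 1 := by
  have h := variance_fun_id_gaussianReal (μ := 0) (v := 1)
  rw [variance_eq_integral (by fun_prop)] at h
  rw [integral_id_gaussianReal] at h
  simpa using h

theorem integrable_exp_sq_gaussianReal {c : ℝ} (hc : c < 1) :
    Integrable (fun x => Real.exp (c * x ^ 2 / 2)) (gaussianReal 0 1) := by
  rw [gaussianReal_of_var_ne_zero _ one_ne_zero,
    integrable_withDensity_iff_integrable_smul' (measurable_gaussianPDF 0 1)
      (ae_of_all _ fun _ => gaussianPDF_lt_top)]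
  have := (integrable_exp_neg_mul_sq (b := (1 - c) / 2) (by linarith)).const_mul ((√(2 * Real.pi))⁻¹)
  refine this.congr (ae_of_all _ fun x => ?_)
  simp only [gaussianPDFReal_def, toReal_gaussianPDF, smul_eq_mul, mul_assoc, ← Real.exp_add,
    NNReal.coe_one, mul_one]
  ring_nf

/-- For `1 ≤ c` both sides are junk values, equal to `0`. -/
theorem integral_exp_sq_gaussianReal (c : ℝ) :
    ∫ x, Real.exp (c * x ^ 2 / 2) ∂(gaussianReal 0 1) = (√(1 - c))⁻¹ := by
  rw [integral_gaussianReal_eq_integral_smul one_ne_zero]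
  have h (x : ℝ) : gaussianPDFReal 0 1 x • Real.exp (c * x ^ 2 / 2)
      = (√(2 * Real.pi))⁻¹ * Real.exp (-((1 - c) / 2) * x ^ 2) := by
    simp only [gaussianPDFReal_def, smul_eq_mul, mul_assoc, ← Real.exp_add, NNReal.coe_one, mul_one]
    ring_nf
  simp_rw [h]
  rw [integral_const_mul, integral_gaussian, ← Real.sqrt_inv, ← Real.sqrt_mul (by positivity),
    ← Real.sqrt_inv]
  congr 1
  have := Real.pi_pos
  field_simp

/-- The first-order term is exact, so that in the second moment of the likelihood ratio the terms
linear in `s` cancel and only `⟨θ, θ'⟩` is left. -/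
theorem inv_sqrt_one_sub_le {c : ℝ} (hc : |c| ≤ 1 / 2) :
    (√(1 - c))⁻¹ ≤ Real.exp (c / 2 + c ^ 2 / 2) := by
  obtain ⟨h1, h2⟩ := abs_le.1 hc
  have h3 : (1 - c)⁻¹ ≤ Real.exp (c + c ^ 2) := by
    rw [inv_le_iff_one_le_mul₀ (by linarith)]
    by_cases h0 : 0 ≤ c
    · have := Real.quadratic_le_exp_of_nonneg (x := c + c ^ 2) (by positivity)
      nlinarith [mul_nonneg (mul_nonneg h0 h0) (sub_nonneg.2 h2),
        mul_nonneg (mul_nonneg (mul_nonneg h0 h0) h0) (sub_nonneg.2 h2),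
        mul_nonneg (mul_nonneg (mul_nonneg (mul_nonneg h0 h0) h0) h0) (sub_nonneg.2 h2),
        mul_le_mul_of_nonneg_left this (by linarith : 0 ≤ 1 - c)]
    · have := Real.add_one_le_exp (c + c ^ 2)
      nlinarith [mul_nonneg (sq_nonneg c) (by linarith : 0 ≤ -c),
        mul_le_mul_of_nonneg_left this (by linarith : 0 ≤ 1 - c)]
  rw [← Real.sqrt_inv]
  calc √(1 - c)⁻¹ ≤ √(Real.exp (c + c ^ 2)) := Real.sqrt_le_sqrt h3
    _ = _ := by rw [← Real.exp_half]; ring_nf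

end

/-! ### Linear forms in Gaussian vectors -/

noncomputable section

variable {Ω : Type*} [MeasurableSpace Ω] {P : Measure Ω} {f : Ω → ℝ} {v : ℝ}

theorem hasLaw_mul_gaussian (a : ℝ) :
    HasLaw (fun x => a * x) (gaussianReal 0 (a ^ 2).toNNReal) (gaussianReal 0 1) where
  aemeasurable := by fun_prop
  map_eq := by
    rw [gaussianReal_map_const_mul]
    congr 1
    · simp
    · ext; simp [Real.coe_toNNReal _ (sq_nonneg a)]

theorem hasLaw_sum_pi {ι : Type*} [Fintype ι] {E : ι → Type*} [∀ i, MeasurableSpace (E i)]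
    {μ : ∀ i, Measure (E i)} [∀ i, IsProbabilityMeasure (μ i)] {f : ∀ i, E i → ℝ} {v : ι → ℝ}
    (hv : ∀ i, 0 ≤ v i) (hf : ∀ i, Measurable (f i))
    (h : ∀ i, HasLaw (f i) (gaussianReal 0 (v i).toNNReal) (μ i)) :
    HasLaw (fun x => ∑ i, f i (x i)) (gaussianReal 0 (∑ i, v i).toNNReal) (Measure.pi μ) := by
  have hm : Measurable fun x : ∀ i, E i => ∑ i, f i (x i) :=
    Finset.measurable_sum _ fun i _ => (hf i).comp (measurable_pi_apply i)
  refine ⟨hm.aemeasurable, ?_⟩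
  · -- characteristic functions of independent summands multiply
    refine Measure.ext_of_charFun (funext fun t => ?_)
    have hi (i : ι) : ∫ x, Complex.exp (t * f i x * Complex.I) ∂(μ i)
        = Complex.exp (-(v i * t ^ 2 / 2)) := by
      have := charFun_gaussianReal (μ := 0) (v := (v i).toNNReal) t
      rw [← (h i).map_eq, charFun_apply_real, integral_map (by fun_prop) (by fun_prop)] at this
      rw [this]
      simp [Real.coe_toNNReal _ (hv i)]
    rw [charFun_apply_real, integral_map hm.aemeasurable (by fun_prop), charFun_gaussianReal,
      Real.coe_toNNReal _ (Finset.sum_nonneg fun i _ => hv i)]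
    have e (x : ∀ i, E i) : Complex.exp (t * (∑ i, f i (x i) : ℝ) * Complex.I)
        = ∏ i, Complex.exp (t * f i (x i) * Complex.I) := by
      rw [← Complex.exp_sum]; push_cast; rw [Finset.mul_sum, Finset.sum_mul]
    simp_rw [e]
    rw [integral_fintype_prod_eq_prod (fun i y => Complex.exp (t * f i y * Complex.I))]
    simp_rw [hi]
    rw [← Complex.exp_sum]; push_cast
    simp [Finset.sum_div, Finset.sum_mul]

theorem hasLaw_add_prod {Ω' : Type*} [MeasurableSpace Ω'] {P' : Measure Ω'} {g : Ω' → ℝ} {w : ℝ}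
    [IsProbabilityMeasure P] [IsProbabilityMeasure P'] (hv : 0 ≤ v) (hw : 0 ≤ w)
    (hf : Measurable f) (hg : Measurable g)
    (h : HasLaw f (gaussianReal 0 v.toNNReal) P) (h' : HasLaw g (gaussianReal 0 w.toNNReal) P') :
    HasLaw (fun x => f x.1 + g x.2) (gaussianReal 0 (v + w).toNNReal) (P.prod P') where
  aemeasurable := by fun_prop
  map_eq := by
    have := gaussianReal_add_gaussianReal_of_indepFun (indepFun_prod (μ := P) (ν := P') hf hg)
      (m₁ := 0) (m₂ := 0) (v₁ := v.toNNReal) (v₂ := w.toNNReal)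
      (by
        rw [← h.map_eq]
        conv_rhs => rw [← Measure.fst_prod (μ := P) (ν := P')]
        rw [Measure.fst, Measure.map_map hf measurable_fst]; rfl)
      (by
        rw [← h'.map_eq]
        conv_rhs => rw [← Measure.snd_prod (μ := P) (ν := P')]
        rw [Measure.snd, Measure.map_map hg measurable_snd]; rfl)
    rw [Real.toNNReal_add hv hw]
    simpa [Pi.add_def] using this

theorem hasLaw_sqrt_mul (hv : 0 ≤ v) :
    HasLaw (fun x => √v * x) (gaussianReal 0 v.toNNReal) (gaussianReal 0 1) := by
  simpa [Real.sq_sqrt hv] using hasLaw_mul_gaussian (√v)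

theorem integral_comp_of_hasLaw (hv : 0 ≤ v) (h : HasLaw f (gaussianReal 0 v.toNNReal) P)
    {φ : ℝ → ℝ} (hφ : Measurable φ) : ∫ ω, φ (f ω) ∂P = ∫ x, φ (√v * x) ∂(gaussianReal 0 1) := by
  have h1 := h.integral_comp (f := φ) hφ.aestronglyMeasurable
  have h2 := (hasLaw_sqrt_mul hv).integral_comp (f := φ) hφ.aestronglyMeasurable
  exact h1.trans h2.symm

theorem memLp_of_hasLaw (h : HasLaw f (gaussianReal 0 v.toNNReal) P) {p : ℝ≥0∞} (hp : p ≠ ∞) :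
    MemLp f p P := by
  have := memLp_id_gaussianReal' (μ := 0) (v := v.toNNReal) p hp
  rw [← h.map_eq, memLp_map_measure_iff (by fun_prop) h.aemeasurable] at this
  exact this

theorem integral_sq_of_hasLaw (hv : 0 ≤ v) (h : HasLaw f (gaussianReal 0 v.toNNReal) P) :
    ∫ ω, f ω ^ 2 ∂P = v := by
  rw [integral_comp_of_hasLaw hv h (φ := fun x => x ^ 2) (by fun_prop)]
  simp_rw [mul_pow]
  rw [integral_const_mul, integral_sq_gaussianReal, Real.sq_sqrt hv, mul_one]

theorem integral_pow_four_of_hasLaw (hv : 0 ≤ v) (h : HasLaw f (gaussianReal 0 v.toNNReal) P) :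
    ∫ ω, f ω ^ 4 ∂P = 3 * v ^ 2 := by
  rw [integral_comp_of_hasLaw hv h (φ := fun x => x ^ 4) (by fun_prop)]
  simp_rw [mul_pow]
  rw [integral_const_mul, integral_pow_four_gaussianReal,
    show √v ^ 4 = (√v ^ 2) ^ 2 by ring, Real.sq_sqrt hv, mul_comm]

theorem integrable_exp_sq_of_hasLaw (hv : 0 ≤ v) (h : HasLaw f (gaussianReal 0 v.toNNReal) P)
    {c : ℝ} (hc : c * v < 1) : Integrable (fun ω => Real.exp (c * f ω ^ 2 / 2)) P := by
  have key := integrable_exp_sq_gaussianReal hc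
  have e : (fun x => Real.exp (c * v * x ^ 2 / 2))
      = (fun y => Real.exp (c * y ^ 2 / 2)) ∘ (fun x => √v * x) := by
    ext x; simp [mul_pow, Real.sq_sqrt hv, mul_assoc]
  rw [e, ← integrable_map_measure (by fun_prop) (by fun_prop), (hasLaw_sqrt_mul hv).map_eq,
    ← h.map_eq, integrable_map_measure (by fun_prop) h.aemeasurable] at key
  exact key

theorem integral_exp_sq_of_hasLaw (hv : 0 ≤ v) (h : HasLaw f (gaussianReal 0 v.toNNReal) P)
    (c : ℝ) : ∫ ω, Real.exp (c * f ω ^ 2 / 2) ∂P = (√(1 - c * v))⁻¹ := by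
  rw [integral_comp_of_hasLaw hv h (φ := fun x => Real.exp (c * x ^ 2 / 2)) (by fun_prop)]
  simp_rw [mul_pow, Real.sq_sqrt hv, ← mul_assoc]
  exact integral_exp_sq_gaussianReal _

/-- A family `g` of random variables such that every linear combination `∑ q, a q * g q` is centred
Gaussian with variance `∑ q, a q ^ 2`; equivalently, a standard Gaussian vector. -/
def IsStdGaussian {ι : Type*} [Fintype ι] (g : ι → Ω → ℝ) (P : Measure Ω) : Prop :=
  ∀ a : ι → ℝ, HasLaw (fun ω => ∑ q, a q * g q ω) (gaussianReal 0 (∑ q, a q ^ 2).toNNReal) P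

namespace IsStdGaussian

variable {ι : Type*} [Fintype ι] {g : ι → Ω → ℝ}

theorem memLp (hg : IsStdGaussian g P) (a : ι → ℝ) {p : ℝ≥0∞} (hp : p ≠ ∞) :
    MemLp (fun ω => ∑ q, a q * g q ω) p P := memLp_of_hasLaw (hg a) hp

theorem memLp_mul (hg : IsStdGaussian g P) (a b : ι → ℝ) :
    MemLp (fun ω => (∑ q, a q * g q ω) * (∑ q, b q * g q ω)) 2 P := by
  have : ENNReal.HolderTriple 4 4 2 := ⟨by
    rw [show (4 : ℝ≥0∞) = 2 * 2 by norm_num, ENNReal.mul_inv (by simp) (by simp), ← mul_add,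
      ENNReal.inv_two_add_inv_two, mul_one]⟩
  exact (hg.memLp b (p := 4) (by simp)).mul (hg.memLp a (p := 4) (by simp))

theorem integrable_prod_four (hg : IsStdGaussian g P) (a b c e : ι → ℝ) :
    Integrable (fun ω => (∑ q, a q * g q ω) * (∑ q, b q * g q ω) *
      ((∑ q, c q * g q ω) * (∑ q, e q * g q ω))) P :=
  (hg.memLp_mul a b).integrable_mul (hg.memLp_mul c e)

theorem integral_sq_mul_sq (hg : IsStdGaussian g P) (a b : ι → ℝ) :
    ∫ ω, (∑ q, a q * g q ω) * (∑ q, a q * g q ω) * ((∑ q, b q * g q ω) * (∑ q, b q * g q ω)) ∂P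
      = (∑ q, a q * a q) * (∑ q, b q * b q) + 2 * (∑ q, a q * b q) ^ 2 := by
  have h4 (a : ι → ℝ) : ∫ ω, (∑ q, a q * g q ω) ^ 4 ∂P = 3 * (∑ q, a q * a q) ^ 2 := by
    simp_rw [← sq]
    exact integral_pow_four_of_hasLaw (Finset.sum_nonneg fun q _ => sq_nonneg _) (hg a)
  have hi (a : ι → ℝ) : Integrable (fun ω => (∑ q, a q * g q ω) ^ 4) P := by
    refine (hg.integrable_prod_four a a a a).congr (ae_of_all _ fun ω => ?_)
    dsimp only; ring
  have e (ω : Ω) : (∑ q, a q * g q ω) * (∑ q, a q * g q ω) *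
      ((∑ q, b q * g q ω) * (∑ q, b q * g q ω))
      = ((∑ q, (a q + b q) * g q ω) ^ 4 + (∑ q, (a q - b q) * g q ω) ^ 4
        - 2 * (∑ q, a q * g q ω) ^ 4 - 2 * (∑ q, b q * g q ω) ^ 4) / 12 := by
    simp only [add_mul, sub_mul, Finset.sum_add_distrib, Finset.sum_sub_distrib]
    ring
  simp_rw [e]
  have i1 := hi (fun q => a q + b q)
  have i2 := hi (fun q => a q - b q)
  rw [integral_div, integral_sub (by fun_prop) ((hi b).const_mul 2),
    integral_sub (by fun_prop) ((hi a).const_mul 2), integral_add i1 i2,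
    integral_const_mul, integral_const_mul, h4 (fun q => a q + b q), h4 (fun q => a q - b q),
    h4 a, h4 b]
  simp only [add_mul, mul_add, sub_mul, mul_sub, Finset.sum_add_distrib, Finset.sum_sub_distrib]
  have : ∑ q, b q * a q = ∑ q, a q * b q := Finset.sum_congr rfl fun q _ => mul_comm _ _
  rw [this]; ring

/-- The instance of Isserlis' theorem that governs the covariance of `Y X` in the regression
model. -/
theorem integral_sq_mul_mul (hg : IsStdGaussian g P) (a b c : ι → ℝ) :
    ∫ ω, (∑ q, a q * g q ω) * (∑ q, a q * g q ω) * ((∑ q, b q * g q ω) * (∑ q, c q * g q ω)) ∂P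
      = (∑ q, a q * a q) * (∑ q, b q * c q) + 2 * ((∑ q, a q * b q) * (∑ q, a q * c q)) := by
  have e (ω : Ω) : (∑ q, a q * g q ω) * (∑ q, a q * g q ω) *
      ((∑ q, b q * g q ω) * (∑ q, c q * g q ω))
      = ((∑ q, a q * g q ω) * (∑ q, a q * g q ω) *
        ((∑ q, (b q + c q) * g q ω) * (∑ q, (b q + c q) * g q ω))
      - (∑ q, a q * g q ω) * (∑ q, a q * g q ω) *
        ((∑ q, (b q - c q) * g q ω) * (∑ q, (b q - c q) * g q ω))) / 4 := by
    simp only [add_mul, sub_mul, Finset.sum_add_distrib, Finset.sum_sub_distrib]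
    ring
  simp_rw [e]
  rw [integral_div, integral_sub (hg.integrable_prod_four a a _ _)
    (hg.integrable_prod_four a a _ _), hg.integral_sq_mul_sq a (fun q => b q + c q),
    hg.integral_sq_mul_sq a (fun q => b q - c q)]
  simp only [add_mul, mul_add, sub_mul, mul_sub, Finset.sum_add_distrib, Finset.sum_sub_distrib]
  have : ∑ q, c q * b q = ∑ q, b q * c q := Finset.sum_congr rfl fun q _ => mul_comm _ _
  rw [this]; ring

theorem integral_mul (hg : IsStdGaussian g P) (a b : ι → ℝ) :
    ∫ ω, (∑ q, a q * g q ω) * (∑ q, b q * g q ω) ∂P = ∑ q, a q * b q := by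
  have h2 (a : ι → ℝ) : ∫ ω, (∑ q, a q * g q ω) ^ 2 ∂P = ∑ q, a q * a q := by
    simp_rw [← sq]
    exact integral_sq_of_hasLaw (Finset.sum_nonneg fun q _ => sq_nonneg _) (hg a)
  have e (ω : Ω) : (∑ q, a q * g q ω) * (∑ q, b q * g q ω)
      = ((∑ q, (a q + b q) * g q ω) ^ 2 - (∑ q, (a q - b q) * g q ω) ^ 2) / 4 := by
    simp only [add_mul, sub_mul, Finset.sum_add_distrib, Finset.sum_sub_distrib]
    ring
  simp_rw [e]
  rw [integral_div, integral_sub (hg.memLp _ (by simp)).integrable_sq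
    (hg.memLp _ (by simp)).integrable_sq, h2 (fun q => a q + b q), h2 (fun q => a q - b q)]
  simp only [add_mul, mul_add, sub_mul, mul_sub, Finset.sum_add_distrib, Finset.sum_sub_distrib]
  have : ∑ q, b q * a q = ∑ q, a q * b q := Finset.sum_congr rfl fun q _ => mul_comm _ _
  rw [this]; ring

end IsStdGaussian

/-- The law of a single row `(X i, ε i)` of the design and the noise. -/
def rowLaw (d : ℕ) : Measure ((Fin d → Fin d → ℝ) × ℝ) :=
  (Measure.pi fun _ => Measure.pi fun _ => gaussianReal 0 1).prod (gaussianReal 0 1)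

instance (d : ℕ) : IsProbabilityMeasure (rowLaw d) := by
  unfold rowLaw; infer_instance

/-- The coordinates of a row: `some (m, l)` is the design entry `X m l`, and `none` the noise. -/
def rowCoord {d : ℕ} : Option (Fin d × Fin d) → (Fin d → Fin d → ℝ) × ℝ → ℝ
  | none => fun w => w.2
  | some q => fun w => w.1 q.1 q.2

theorem isStdGaussian_rowCoord (d : ℕ) : IsStdGaussian (rowCoord (d := d)) (rowLaw d) := by
  intro a
  have h1 (c : ℝ) := hasLaw_mul_gaussian c
  have h2 (m : Fin d) := hasLaw_sum_pi (μ := fun _ : Fin d => gaussianReal 0 1)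
    (fun l => sq_nonneg (a (some (m, l)))) (fun l => by fun_prop) (fun l => h1 (a (some (m, l))))
  have h3 := hasLaw_sum_pi (μ := fun _ : Fin d => Measure.pi fun _ : Fin d => gaussianReal 0 1)
    (fun m => Finset.sum_nonneg fun l _ => sq_nonneg (a (some (m, l)))) (fun l => by fun_prop) h2
  have h4 := hasLaw_add_prod (Finset.sum_nonneg fun m _ =>
    Finset.sum_nonneg fun l _ => sq_nonneg (a (some (m, l)))) (sq_nonneg (a none))
    (by fun_prop) (by fun_prop) h3 (h1 (a none))
  simp only [Fintype.sum_option, Fintype.sum_prod_type, rowCoord]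
  rw [add_comm (a none ^ 2)]
  simp_rw [add_comm (a none * _)]
  exact h4

end

/-! ### Second moments of linear and quadratic sums over independent rows -/

noncomputable section

variable {Ω : Type*} [MeasurableSpace Ω] {P : Measure Ω} [IsProbabilityMeasure P] {n : ℕ}

theorem sum_sum_Ioi_one (n : ℕ) :
    (∑ i : Fin n, ∑ _j ∈ Finset.Ioi i, (1 : ℝ)) = n * (n - 1) / 2 := by
  have h : (∑ i : Fin n, (Finset.Ioi i).card) * 2 = n * (n - 1) := by
    simp only [Fin.card_Ioi]
    rw [Fin.sum_univ_eq_sum_range (fun i => n - 1 - i) n, Finset.sum_range_reflect (fun i => i),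
      Finset.sum_range_id_mul_two]
  have h' : ((∑ i : Fin n, (Finset.Ioi i).card : ℕ) : ℝ) * 2 = n * (n - 1) := by
    rcases n with _ | n
    · simp
    · have := congrArg (Nat.cast : ℕ → ℝ) h
      push_cast at this ⊢; simpa using this
  simp only [Finset.sum_const, nsmul_eq_mul, mul_one]
  push_cast at h' ⊢; linarith

theorem prod_ite_pair {κ : Type*} [Fintype κ] [DecidableEq κ] {i j : κ} (hij : i ≠ j) (f : κ → ℝ) :
    ∏ m, (if m = i ∨ m = j then f m else 1) = f i * f j := by
  rw [Finset.prod_ite, Finset.prod_const_one, mul_one,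
    show Finset.univ.filter (fun m => m = i ∨ m = j) = {i, j} by ext; simp,
    Finset.prod_pair hij]

theorem integrable_pairs {f g : Ω → ℝ} (hf : MemLp f 2 P) (hg : MemLp g 2 P) {i j k l : Fin n}
    (hij : i < j) (hkl : k < l) :
    Integrable (fun ω : Fin n → Ω => f (ω i) * f (ω j) * (g (ω k) * g (ω l)))
      (Measure.pi fun _ => P) := by
  have key : Integrable (fun ω : Fin n → Ω => ∏ m, ((if m = i ∨ m = j then f (ω m) else 1) *
      (if m = k ∨ m = l then g (ω m) else 1))) (Measure.pi fun _ => P) := by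
    refine Integrable.fintype_prod (f := fun m x => (if m = i ∨ m = j then f x else 1) *
      (if m = k ∨ m = l then g x else 1)) fun m => ?_
    have h1 := hf.integrable (by simp)
    have h2 := hg.integrable (by simp)
    have h3 := hf.integrable_mul hg
    split_ifs
    · exact h3
    · simpa using h1
    · simpa using h2
    · simp
  simpa only [Finset.prod_mul_distrib, prod_ite_pair hij.ne (fun m => f _),
    prod_ite_pair hkl.ne (fun m => g _)] using key

/-- Orthogonality of the summands of a degenerate U-statistic: the integral factorises over the
rows, and a row that occurs only once contributes the factor zero. -/
theorem integral_pairs {f g : Ω → ℝ} (hf : ∫ x, f x ∂P = 0) (hg : ∫ x, g x ∂P = 0)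
    {i j k l : Fin n} (hij : i < j) (hkl : k < l) :
    ∫ ω : Fin n → Ω, f (ω i) * f (ω j) * (g (ω k) * g (ω l)) ∂(Measure.pi fun _ => P)
      = if i = k ∧ j = l then (∫ x, f x * g x ∂P) ^ 2 else 0 := by
  have e (ω : Fin n → Ω) : f (ω i) * f (ω j) * (g (ω k) * g (ω l))
      = ∏ m, ((if m = i ∨ m = j then f (ω m) else 1) *
      (if m = k ∨ m = l then g (ω m) else 1)) := by
    rw [Finset.prod_mul_distrib, prod_ite_pair hij.ne (fun m => f (ω m)),
      prod_ite_pair hkl.ne (fun m => g (ω m))]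
  simp_rw [e]
  rw [integral_fintype_prod_eq_prod (fun m x => (if m = i ∨ m = j then f x else 1) *
      (if m = k ∨ m = l then g x else 1))]
  split_ifs with h
  · obtain ⟨rfl, rfl⟩ := h
    rw [sq, ← prod_ite_pair hij.ne (fun _ => ∫ x, f x * g x ∂P)]
    refine Finset.prod_congr rfl fun m _ => ?_
    by_cases hm : m = i ∨ m = j <;> simp [hm]
  · -- some index occurs in exactly one of the two pairs
    have : ∃ m, (¬ (m = i ∨ m = j) ∧ (m = k ∨ m = l)) ∨ ((m = i ∨ m = j) ∧ ¬ (m = k ∨ m = l)) := by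
      by_contra! H
      have h1 := H i; have h2 := H j; have h3 := H k; have h4 := H l
      grind
    obtain ⟨m, ⟨h1, h2⟩ | ⟨h1, h2⟩⟩ := this
    · exact Finset.prod_eq_zero (Finset.mem_univ m) (by simp [h1, h2, hg])
    · exact Finset.prod_eq_zero (Finset.mem_univ m) (by simp [h1, h2, hf])

/-- The second moment of a completely degenerate U-statistic of order two: its summands are
pairwise orthogonal. -/
theorem integral_degenerate_sq {ι : Type*} [Fintype ι] {D : ι → Ω → ℝ} (hD : ∀ a, MemLp (D a) 2 P)
    (h0 : ∀ a, ∫ x, D a x ∂P = 0) :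
    Integrable (fun ω : Fin n → Ω => (∑ i, ∑ j ∈ Finset.Ioi i, ∑ a, D a (ω i) * D a (ω j)) ^ 2)
      (Measure.pi fun _ => P) ∧
    ∫ ω : Fin n → Ω, (∑ i, ∑ j ∈ Finset.Ioi i, ∑ a, D a (ω i) * D a (ω j)) ^ 2
      ∂(Measure.pi fun _ => P) = n * (n - 1) / 2 * ∑ a, ∑ b, (∫ x, D a x * D b x ∂P) ^ 2 := by
  have e (ω : Fin n → Ω) : (∑ i, ∑ j ∈ Finset.Ioi i, ∑ a, D a (ω i) * D a (ω j)) ^ 2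
      = ∑ i, ∑ j ∈ Finset.Ioi i, ∑ k, ∑ l ∈ Finset.Ioi k, ∑ a, ∑ b,
        D a (ω i) * D a (ω j) * (D b (ω k) * D b (ω l)) := by
    rw [sq, Finset.sum_mul]
    refine Finset.sum_congr rfl fun i _ => ?_
    rw [Finset.sum_mul]
    refine Finset.sum_congr rfl fun j _ => ?_
    rw [Finset.mul_sum]
    refine Finset.sum_congr rfl fun k _ => ?_
    rw [Finset.mul_sum]
    exact Finset.sum_congr rfl fun l _ => Finset.sum_mul_sum ..
  have hi : ∀ i : Fin n, ∀ j ∈ Finset.Ioi i, ∀ k : Fin n, ∀ l ∈ Finset.Ioi k, ∀ a b,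
      Integrable (fun ω : Fin n → Ω => D a (ω i) * D a (ω j) * (D b (ω k) * D b (ω l)))
        (Measure.pi fun _ => P) := fun i j hj k l hl a b =>
    integrable_pairs (hD a) (hD b) (Finset.mem_Ioi.1 hj) (Finset.mem_Ioi.1 hl)
  simp_rw [e]
  constructor
  · exact integrable_finsetSum _ fun i _ => integrable_finsetSum _ fun j hj =>
      integrable_finsetSum _ fun k _ => integrable_finsetSum _ fun l hl =>
      integrable_finsetSum _ fun a _ => integrable_finsetSum _ fun b _ => hi i j hj k l hl a b
  · rw [← sum_sum_Ioi_one, Finset.sum_mul,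
      integral_finsetSum _ fun i _ => integrable_finsetSum _ fun j hj =>
      integrable_finsetSum _ fun k _ => integrable_finsetSum _ fun l hl =>
      integrable_finsetSum _ fun a _ => integrable_finsetSum _ fun b _ => hi i j hj k l hl a b]
    refine Finset.sum_congr rfl fun i _ => ?_
    rw [Finset.sum_mul, integral_finsetSum _ fun j hj =>
      integrable_finsetSum _ fun k _ => integrable_finsetSum _ fun l hl =>
      integrable_finsetSum _ fun a _ => integrable_finsetSum _ fun b _ => hi i j hj k l hl a b]
    refine Finset.sum_congr rfl fun j hj => ?_
    rw [integral_finsetSum _ fun k _ => integrable_finsetSum _ fun l hl =>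
      integrable_finsetSum _ fun a _ => integrable_finsetSum _ fun b _ => hi i j hj k l hl a b]
    have h1 : ∀ k : Fin n, ∀ l ∈ Finset.Ioi k, ∫ ω : Fin n → Ω, ∑ a, ∑ b,
        D a (ω i) * D a (ω j) * (D b (ω k) * D b (ω l)) ∂(Measure.pi fun _ => P)
        = if i = k ∧ j = l then ∑ a, ∑ b, (∫ x, D a x * D b x ∂P) ^ 2 else 0 := by
      intro k l hl
      rw [integral_finsetSum _ fun a _ => integrable_finsetSum _ fun b _ => hi i j hj k l hl a b]
      simp_rw [integral_finsetSum _ fun b _ => hi i j hj k l hl _ b,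
        integral_pairs (h0 _) (h0 _) (Finset.mem_Ioi.1 hj) (Finset.mem_Ioi.1 hl)]
      split_ifs <;> simp
    have h2 (k : Fin n) : ∫ ω : Fin n → Ω, ∑ l ∈ Finset.Ioi k, ∑ a, ∑ b,
        D a (ω i) * D a (ω j) * (D b (ω k) * D b (ω l)) ∂(Measure.pi fun _ => P)
        = if i = k then ∑ a, ∑ b, (∫ x, D a x * D b x ∂P) ^ 2 else 0 := by
      rw [integral_finsetSum _ fun l hl =>
        integrable_finsetSum _ fun a _ => integrable_finsetSum _ fun b _ => hi i j hj k l hl a b,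
        Finset.sum_congr rfl (h1 k)]
      by_cases hik : i = k
      · subst hik; simp [Finset.mem_Ioi.1 hj]
      · simp [hik]
    simp_rw [h2]
    simp

theorem integral_sum_sq {g : Ω → ℝ} (hg : MemLp g 2 P) (h0 : ∫ x, g x ∂P = 0) :
    Integrable (fun ω : Fin n → Ω => (∑ i, g (ω i)) ^ 2) (Measure.pi fun _ => P) ∧
    ∫ ω : Fin n → Ω, (∑ i, g (ω i)) ^ 2 ∂(Measure.pi fun _ => P) = n * ∫ x, g x ^ 2 ∂P := by
  have hm (i : Fin n) : MemLp (fun ω : Fin n → Ω => g (ω i)) 2 (Measure.pi fun _ => P) :=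
    hg.comp_measurePreserving (measurePreserving_eval (fun _ => P) i)
  have hs := memLp_finsetSum Finset.univ fun i _ => hm i
  refine ⟨hs.integrable_sq, ?_⟩
  have hz : ∫ ω : Fin n → Ω, ∑ i, g (ω i) ∂(Measure.pi fun _ => P) = 0 := by
    rw [integral_finsetSum _ fun i _ => (hm i).integrable (by simp)]
    refine Finset.sum_eq_zero fun i _ => ?_
    rw [integral_comp_eval (μ := fun _ => P) (i := i) hg.1, h0]
  have hv := variance_sum_pi (μ := fun _ : Fin n => P) (X := fun _ => g) fun _ => hg
  have e : (∑ i, fun ω : Fin n → Ω => g (ω i)) = fun ω => ∑ i, g (ω i) := by ext; simp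
  rw [e, variance_eq_integral hs.1.aemeasurable] at hv
  simp_rw [variance_eq_integral hg.1.aemeasurable, h0] at hv
  simpa [hz] using hv

end

/-! ### The sample as independent rows, and the chi-square statistic -/

noncomputable section

variable {n d : ℕ}

/-- The squared Frobenius norm. The index pair `q = (m, l)` is that of the design entry `X m l`,
which `tr (X θ)` multiplies with `θ l m`; hence the transposed indexing of `θ`. -/
def frobSq (θ : Matrix (Fin d) (Fin d) ℝ) : ℝ := ∑ q : Fin d × Fin d, θ q.2 q.1 ^ 2

theorem frobSq_nonneg (θ : Matrix (Fin d) (Fin d) ℝ) : 0 ≤ frobSq θ :=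
  Finset.sum_nonneg fun _ _ => sq_nonneg _

theorem trace_transpose_mul_self (θ : Matrix (Fin d) (Fin d) ℝ) :
    (θ.transpose * θ).trace = frobSq θ := by
  simp [Matrix.trace, Matrix.mul_apply, frobSq, Fintype.sum_prod_type, sq]

theorem frobeniusNorm_sq (θ : Matrix (Fin d) (Fin d) ℝ) : frobeniusNorm θ ^ 2 = frobSq θ := by
  rw [frobeniusNorm, trace_transpose_mul_self, Real.sq_sqrt (frobSq_nonneg θ)]

/-- The coefficients of the response `tr (x θ) + ε` as a linear form in the coordinates
`rowCoord` of the row `(x, ε)`. -/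
def responseCoeff (θ : Matrix (Fin d) (Fin d) ℝ) : Option (Fin d × Fin d) → ℝ
  | none => 1
  | some q => θ q.2 q.1

/-- The response `tr (x θ) + ε` of a row `(x, ε)`. -/
def response (θ : Matrix (Fin d) (Fin d) ℝ) (w : (Fin d → Fin d → ℝ) × ℝ) : ℝ :=
  ∑ q, responseCoeff θ q * rowCoord q w

theorem response_eq (θ : Matrix (Fin d) (Fin d) ℝ) (w : (Fin d → Fin d → ℝ) × ℝ) :
    response θ w = (Matrix.of w.1 * θ).trace + w.2 := by
  simp [response, responseCoeff, rowCoord, Fintype.sum_option, Fintype.sum_prod_type,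
    Matrix.trace, Matrix.mul_apply, mul_comm, add_comm]

@[fun_prop]
theorem measurable_rowCoord (q : Option (Fin d × Fin d)) : Measurable (rowCoord q) := by
  cases q <;> unfold rowCoord <;> fun_prop

@[fun_prop]
theorem measurable_response (θ : Matrix (Fin d) (Fin d) ℝ) : Measurable (response θ) := by
  unfold response; fun_prop

theorem sum_responseCoeff_mul_self (θ : Matrix (Fin d) (Fin d) ℝ) :
    ∑ q, responseCoeff θ q * responseCoeff θ q = 1 + frobSq θ := by
  simp [responseCoeff, Fintype.sum_option, frobSq, sq]

/-- The observation assembled from `n` independent rows. -/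
def observeRows (θ : Matrix (Fin d) (Fin d) ℝ) (ω : Fin n → (Fin d → Fin d → ℝ) × ℝ) :
    Observation n d :=
  (fun i => response θ (ω i), fun i => (ω i).1)

theorem measurable_observeRows (θ : Matrix (Fin d) (Fin d) ℝ) :
    Measurable (observeRows (n := n) θ) := by
  unfold observeRows; fun_prop

/-- Regroups the design and the noise by rows, which turns `law` into the image of a product
measure. -/
theorem law_eq_map (θ : Matrix (Fin d) (Fin d) ℝ) :
    law n θ = (Measure.pi fun _ : Fin n => rowLaw d).map (observeRows θ) := by
  have h := measurePreserving_arrowProdEquivProdArrow (Fin d → Fin d → ℝ) ℝ (Fin n)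
    (fun _ => Measure.pi fun _ => Measure.pi fun _ => gaussianReal 0 1) (fun _ => gaussianReal 0 1)
  rw [law, designLaw, noiseLaw, ← h.map_eq, Measure.map_map (measurable_observe θ) h.measurable]
  congr 1
  ext1 ω
  simp [observe, observeRows, response_eq, sampling, MeasurableEquiv.arrowProdEquivProdArrow,
    Equiv.arrowProdEquivProdArrow]

theorem law_apply (θ : Matrix (Fin d) (Fin d) ℝ) {A : Set (Observation n d)}
    (hA : MeasurableSet A) :
    law n θ A = (Measure.pi fun _ : Fin n => rowLaw d) {ω | observeRows θ ω ∈ A} := by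
  rw [law_eq_map, Measure.map_apply (measurable_observeRows θ) hA]; rfl

@[fun_prop]
theorem measurable_chiSquareStat : Measurable (chiSquareStat (n := n) (d := d)) := by
  unfold chiSquareStat; fun_prop

@[fun_prop]
theorem measurable_uStat : Measurable (uStat (n := n) (d := d)) := by
  unfold uStat; fun_prop

theorem measurableSet_explicitTest (c : ℝ) : MeasurableSet (explicitTest n d c) := by
  unfold explicitTest
  split_ifs
  · exact measurableSet_le measurable_const measurable_chiSquareStat
  · exact measurableSet_le measurable_const measurable_uStat

/-- A form of Chebyshev's inequality. -/
theorem measure_le_of_integral_sq {Ω : Type*} [MeasurableSpace Ω] {Q : Measure Ω}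
    [IsProbabilityMeasure Q] {f : Ω → ℝ} (hf : Integrable (fun ω => f ω ^ 2) Q) {V t : ℝ}
    (hV : ∫ ω, f ω ^ 2 ∂Q ≤ V) (ht : 0 < t) {S : Set Ω} (hS : ∀ ω ∈ S, t ≤ |f ω|) :
    Q S ≤ ENNReal.ofReal (V / t ^ 2) := by
  have h1 := mul_meas_ge_le_integral_of_nonneg (ae_of_all _ fun ω => sq_nonneg (f ω)) hf (t ^ 2)
  have h2 : Q.real S ≤ V / t ^ 2 := by
    rw [le_div_iff₀ (by positivity), mul_comm]
    refine le_trans (mul_le_mul_of_nonneg_left (measureReal_mono fun ω hω => ?_) (by positivity))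
      (h1.trans hV)
    have := hS ω hω
    simpa using pow_le_pow_left₀ ht.le this 2
  rw [← ofReal_measureReal]
  exact ENNReal.ofReal_le_ofReal h2

theorem chiSquareStat_second_moment (hn : 0 < n) (θ : Matrix (Fin d) (Fin d) ℝ) :
    Integrable (fun ω => (chiSquareStat (observeRows θ ω) - frobSq θ) ^ 2)
      (Measure.pi fun _ : Fin n => rowLaw d) ∧
    ∫ ω, (chiSquareStat (observeRows θ ω) - frobSq θ) ^ 2 ∂(Measure.pi fun _ : Fin n => rowLaw d)
      = 2 * (1 + frobSq θ) ^ 2 / n := by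
  have hg := isStdGaussian_rowCoord d
  set s := frobSq θ
  have hn' : (n : ℝ) ≠ 0 := by positivity
  have hm : MemLp (fun w => response θ w * response θ w) 2 (rowLaw d) := hg.memLp_mul _ _
  have hm' : MemLp (fun w => response θ w * response θ w - (1 + s)) 2 (rowLaw d) :=
    hm.sub (memLp_const _)
  have i0 : ∫ w, response θ w * response θ w ∂(rowLaw d) = 1 + s :=
    (hg.integral_mul _ _).trans (sum_responseCoeff_mul_self θ)
  have i4 : ∫ w, response θ w * response θ w * (response θ w * response θ w) ∂(rowLaw d)
      = 3 * (1 + s) ^ 2 := by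
    have := hg.integral_sq_mul_sq (responseCoeff θ) (responseCoeff θ)
    rw [sum_responseCoeff_mul_self] at this
    exact this.trans (by ring)
  have i1 : ∫ w, (response θ w * response θ w - (1 + s)) ∂(rowLaw d) = 0 := by
    rw [integral_sub (hm.integrable (by simp)) (integrable_const _), i0]; simp
  have i2 : ∫ w, (response θ w * response θ w - (1 + s)) ^ 2 ∂(rowLaw d) = 2 * (1 + s) ^ 2 := by
    have e (w : (Fin d → Fin d → ℝ) × ℝ) : (response θ w * response θ w - (1 + s)) ^ 2 =
        response θ w * response θ w * (response θ w * response θ w)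
        - 2 * (1 + s) * (response θ w * response θ w) + (1 + s) ^ 2 := by ring
    simp_rw [e]
    have j1 := hm.integrable_mul hm
    have j2 := (hm.integrable (by simp)).const_mul (2 * (1 + s))
    have j3 : Integrable (fun _ : (Fin d → Fin d → ℝ) × ℝ => (1 + s) ^ 2) (rowLaw d) :=
      integrable_const _
    rw [integral_add (by exact j1.sub j2) j3, integral_sub (by exact j1) j2, i4,
      integral_const_mul, i0]
    simp; ring
  obtain ⟨h1, h2⟩ := integral_sum_sq (n := n) hm' i1
  have e (ω : Fin n → (Fin d → Fin d → ℝ) × ℝ) : (chiSquareStat (observeRows θ ω) - s) ^ 2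
      = (1 / (n : ℝ)) ^ 2 * (∑ i, (response θ (ω i) * response θ (ω i) - (1 + s))) ^ 2 := by
    rw [← mul_pow]; congr 1
    simp only [chiSquareStat, observeRows, Finset.sum_sub_distrib, ← sq]
    simp
    field_simp
    ring
  simp_rw [e]
  refine ⟨h1.const_mul _, ?_⟩
  rw [integral_const_mul, h2, i2]
  field_simp

theorem sum_Ioi_add (h : Fin n → ℝ) :
    ∑ i, ∑ j ∈ Finset.Ioi i, (h i + h j) = (n - 1) * ∑ i, h i := by
  have e : ∑ i, ∑ j ∈ Finset.Ioi i, h j = ∑ j, ∑ i ∈ Finset.Iio j, h j :=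
    Finset.sum_comm' (by simp)
  simp only [Finset.sum_add_distrib]
  rw [e, ← Finset.sum_add_distrib, Finset.mul_sum]
  refine Finset.sum_congr rfl fun i _ => ?_
  simp only [Finset.sum_const, nsmul_eq_mul, Fin.card_Ioi, Fin.card_Iio]
  have hi := i.2
  rw [← add_mul, ← Nat.cast_add, show n - 1 - (i : ℕ) + i = n - 1 by omega,
    Nat.cast_sub (by omega), Nat.cast_one]

end

/-! ### The U-statistic -/

noncomputable section

variable {n d : ℕ}

/-- The centred products `Y X m l - E (Y X m l)`. -/
def centredScore (θ : Matrix (Fin d) (Fin d) ℝ) (q : Fin d × Fin d)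
    (w : (Fin d → Fin d → ℝ) × ℝ) : ℝ :=
  response θ w * w.1 q.1 q.2 - θ q.2 q.1

theorem sum_single_mul_rowCoord (q : Fin d × Fin d) (w : (Fin d → Fin d → ℝ) × ℝ) :
    ∑ p, (Pi.single (some q) 1 : Option (Fin d × Fin d) → ℝ) p * rowCoord p w = w.1 q.1 q.2 := by
  simp [Pi.single_apply, rowCoord]

theorem memLp_centredScore (θ : Matrix (Fin d) (Fin d) ℝ) (q : Fin d × Fin d) :
    MemLp (centredScore θ q) 2 (rowLaw d) := by
  have h := (isStdGaussian_rowCoord d).memLp_mul (responseCoeff θ) (Pi.single (some q) 1)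
  simp_rw [sum_single_mul_rowCoord] at h
  exact h.sub (memLp_const _)

theorem integral_response_mul (θ : Matrix (Fin d) (Fin d) ℝ) (q : Fin d × Fin d) :
    Integrable (fun w => response θ w * w.1 q.1 q.2) (rowLaw d) ∧
    ∫ w, response θ w * w.1 q.1 q.2 ∂(rowLaw d) = θ q.2 q.1 := by
  have h := (isStdGaussian_rowCoord d).memLp_mul (responseCoeff θ) (Pi.single (some q) 1)
  have h' := (isStdGaussian_rowCoord d).integral_mul (responseCoeff θ) (Pi.single (some q) 1)
  simp_rw [sum_single_mul_rowCoord] at h h'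
  exact ⟨h.integrable (by simp), h'.trans (by simp [Pi.single_apply, responseCoeff])⟩

theorem integral_centredScore (θ : Matrix (Fin d) (Fin d) ℝ) (q : Fin d × Fin d) :
    ∫ w, centredScore θ q w ∂(rowLaw d) = 0 := by
  obtain ⟨h1, h2⟩ := integral_response_mul θ q
  unfold centredScore
  rw [integral_sub h1 (integrable_const _), h2]; simp

theorem integral_centredScore_mul (θ : Matrix (Fin d) (Fin d) ℝ) (q p : Fin d × Fin d) :
    ∫ w, centredScore θ q w * centredScore θ p w ∂(rowLaw d)
      = (if q = p then 1 + frobSq θ else 0) + θ q.2 q.1 * θ p.2 p.1 := by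
  have hg := isStdGaussian_rowCoord d
  have h := hg.integrable_prod_four (responseCoeff θ) (responseCoeff θ)
    (Pi.single (some q) 1) (Pi.single (some p) 1)
  have h' := hg.integral_sq_mul_mul (responseCoeff θ) (Pi.single (some q) 1) (Pi.single (some p) 1)
  simp_rw [sum_single_mul_rowCoord] at h h'
  rw [sum_responseCoeff_mul_self] at h'
  have e (w : (Fin d → Fin d → ℝ) × ℝ) : centredScore θ q w * centredScore θ p w
      = response θ w * response θ w * (w.1 q.1 q.2 * w.1 p.1 p.2)
        - θ p.2 p.1 * (response θ w * w.1 q.1 q.2) - θ q.2 q.1 * (response θ w * w.1 p.1 p.2)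
        + θ q.2 q.1 * θ p.2 p.1 := by
    unfold centredScore; ring
  obtain ⟨q1, q2⟩ := integral_response_mul θ q
  obtain ⟨p1, p2⟩ := integral_response_mul θ p
  simp_rw [e]
  have j1 : Integrable (fun w => response θ w * response θ w * (w.1 q.1 q.2 * w.1 p.1 p.2))
    (rowLaw d) := h
  have j2 := q1.const_mul (θ p.2 p.1)
  have j3 := p1.const_mul (θ q.2 q.1)
  rw [integral_add (by exact (j1.sub j2).sub j3) (integrable_const _),
    integral_sub (by exact j1.sub j2) j3, integral_sub j1 j2, integral_const_mul, integral_const_mul, q2, p2, show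
    ∫ w, response θ w * response θ w * (w.1 q.1 q.2 * w.1 p.1 p.2) ∂(rowLaw d) = _ from h']
  have e2 : ∑ r, (Pi.single (some q) 1 : Option (Fin d × Fin d) → ℝ) r *
      (Pi.single (some p) 1 : Option (Fin d × Fin d) → ℝ) r = if q = p then 1 else 0 := by
    simp only [Pi.single_apply, ite_mul, one_mul, zero_mul, Finset.sum_ite_eq', Finset.mem_univ,
      if_true, Option.some_inj]
  have e3 (r : Fin d × Fin d) : ∑ t, responseCoeff θ t *
      (Pi.single (some r) 1 : Option (Fin d × Fin d) → ℝ) t = θ r.2 r.1 := by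
    simp [Pi.single_apply, responseCoeff]
  rw [e2, e3, e3]
  split_ifs <;> simp <;> ring

theorem sum_covariance_sq (θ : Matrix (Fin d) (Fin d) ℝ) :
    ∑ q, ∑ p, (∫ w, centredScore θ q w * centredScore θ p w ∂(rowLaw d)) ^ 2
      = (1 + frobSq θ) ^ 2 * d ^ 2 + 2 * (1 + frobSq θ) * frobSq θ + frobSq θ ^ 2 := by
  simp_rw [integral_centredScore_mul]
  have e (q p : Fin d × Fin d) :
      ((if q = p then 1 + frobSq θ else 0) + θ q.2 q.1 * θ p.2 p.1) ^ 2
      = (if q = p then (1 + frobSq θ) ^ 2 + 2 * (1 + frobSq θ) * θ q.2 q.1 ^ 2 else 0)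
        + θ q.2 q.1 ^ 2 * θ p.2 p.1 ^ 2 := by
    split_ifs with h
    · subst h; ring
    · ring
  simp_rw [e, Finset.sum_add_distrib]
  rw [← Finset.sum_mul_sum]
  simp [Finset.sum_add_distrib, ← Finset.mul_sum]
  simp only [frobSq]; ring

/-- Moments of the projection `⟨θ, Y X - E (Y X)⟩` that makes up the linear part. -/
theorem linear_part_moments (θ : Matrix (Fin d) (Fin d) ℝ) :
    MemLp (fun w => ∑ q, θ q.2 q.1 * centredScore θ q w) 2 (rowLaw d) ∧
    ∫ w, ∑ q, θ q.2 q.1 * centredScore θ q w ∂(rowLaw d) = 0 ∧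
    ∫ w, (∑ q, θ q.2 q.1 * centredScore θ q w) ^ 2 ∂(rowLaw d)
      = (1 + frobSq θ) * frobSq θ + frobSq θ ^ 2 := by
  have hD := memLp_centredScore θ
  refine ⟨memLp_finsetSum _ fun q _ => (hD q).const_mul _, ?_, ?_⟩
  · rw [integral_finsetSum _ fun q _ => ((hD q).integrable (by simp)).const_mul _]
    simp [integral_const_mul, integral_centredScore]
  · have e (w : (Fin d → Fin d → ℝ) × ℝ) : (∑ q, θ q.2 q.1 * centredScore θ q w) ^ 2
        = ∑ q, ∑ p, θ q.2 q.1 * θ p.2 p.1 * (centredScore θ q w * centredScore θ p w) := by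
      rw [sq, Finset.sum_mul_sum]
      exact Finset.sum_congr rfl fun q _ => Finset.sum_congr rfl fun p _ => by ring
    have hi (q p : Fin d × Fin d) : Integrable (fun w => θ q.2 q.1 * θ p.2 p.1 *
        (centredScore θ q w * centredScore θ p w)) (rowLaw d) :=
      ((hD q).integrable_mul (hD p)).const_mul _
    simp_rw [e]
    rw [integral_finsetSum _ fun q _ => integrable_finsetSum _ fun p _ => hi q p]
    simp_rw [integral_finsetSum _ fun p _ => hi _ p, integral_const_mul,
      integral_centredScore_mul]
    have e2 (q p : Fin d × Fin d) : θ q.2 q.1 * θ p.2 p.1 *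
        ((if q = p then 1 + frobSq θ else 0) + θ q.2 q.1 * θ p.2 p.1)
        = (if q = p then (1 + frobSq θ) * θ q.2 q.1 ^ 2 else 0)
          + θ q.2 q.1 ^ 2 * θ p.2 p.1 ^ 2 := by
      split_ifs with h
      · subst h; ring
      · ring
    simp_rw [e2, Finset.sum_add_distrib]
    rw [← Finset.sum_mul_sum]
    simp [← Finset.mul_sum]
    simp only [frobSq]; ring

/-- Hoeffding decomposition of the U-statistic into its mean, a linear and a degenerate part. -/
theorem uStat_decomposition (hn : 2 ≤ n) (θ : Matrix (Fin d) (Fin d) ℝ)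
    (ω : Fin n → (Fin d → Fin d → ℝ) × ℝ) :
    uStat (observeRows θ ω) - frobSq θ
      = 2 / ((n : ℝ) * (n - 1)) *
          (∑ i, ∑ j ∈ Finset.Ioi i, ∑ q, centredScore θ q (ω i) * centredScore θ q (ω j))
        + 2 / (n : ℝ) * ∑ i, ∑ q, θ q.2 q.1 * centredScore θ q (ω i) := by
  have hn1 : (n : ℝ) ≠ 0 := by positivity
  have hn2 : (n : ℝ) - 1 ≠ 0 := by
    have : (2 : ℝ) ≤ n := by exact_mod_cast hn
    linarith
  have e : ∑ i : Fin n, ∑ j ∈ Finset.Ioi i, ∑ m : Fin d, ∑ l : Fin d,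
      (observeRows θ ω).1 i * (observeRows θ ω).2 i m l *
        ((observeRows θ ω).1 j * (observeRows θ ω).2 j m l)
      = (∑ i, ∑ j ∈ Finset.Ioi i, ∑ q, centredScore θ q (ω i) * centredScore θ q (ω j))
        + (n - 1) * (∑ i, ∑ q, θ q.2 q.1 * centredScore θ q (ω i))
        + n * (n - 1) / 2 * frobSq θ := by
    rw [← sum_Ioi_add (fun i => ∑ q, θ q.2 q.1 * centredScore θ q (ω i)), ← sum_sum_Ioi_one,
      Finset.sum_mul, ← Finset.sum_add_distrib, ← Finset.sum_add_distrib]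
    refine Finset.sum_congr rfl fun i _ => ?_
    rw [Finset.sum_mul, ← Finset.sum_add_distrib, ← Finset.sum_add_distrib]
    refine Finset.sum_congr rfl fun j _ => ?_
    rw [frobSq, one_mul, ← Finset.sum_add_distrib, ← Finset.sum_add_distrib,
      ← Finset.sum_add_distrib, ← Fintype.sum_prod_type']
    refine Finset.sum_congr rfl fun q _ => ?_
    simp only [centredScore, observeRows]; ring
  rw [uStat, e]
  field_simp
  ring

theorem uStat_second_moment (hn : 2 ≤ n) (hd : 1 ≤ d) (θ : Matrix (Fin d) (Fin d) ℝ) :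
    Integrable (fun ω => (uStat (observeRows θ ω) - frobSq θ) ^ 2)
      (Measure.pi fun _ : Fin n => rowLaw d) ∧
    ∫ ω, (uStat (observeRows θ ω) - frobSq θ) ^ 2 ∂(Measure.pi fun _ : Fin n => rowLaw d)
      ≤ 32 * (1 + frobSq θ) ^ 2 * d ^ 2 / n ^ 2 + 16 * (frobSq θ + frobSq θ ^ 2) / n := by
  obtain ⟨h1, h2, h3⟩ := linear_part_moments θ
  obtain ⟨l1, l2⟩ := integral_sum_sq (n := n) h1 h2
  obtain ⟨q1, q2⟩ := integral_degenerate_sq (n := n) (memLp_centredScore θ)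
    (integral_centredScore θ)
  rw [h3] at l2
  rw [sum_covariance_sq] at q2
  simp_rw [uStat_decomposition hn θ]
  set α : ℝ := 2 / ((n : ℝ) * (n - 1)) with hα
  set β : ℝ := 2 / (n : ℝ) with hβ
  have hs := frobSq_nonneg θ
  set s := frobSq θ
  have hn' : (2 : ℝ) ≤ n := by exact_mod_cast hn
  have hd' : (1 : ℝ) ≤ (d : ℝ) ^ 2 := by exact_mod_cast Nat.one_le_pow _ _ hd
  have hb : ∀ ω : Fin n → (Fin d → Fin d → ℝ) × ℝ,
      (α * (∑ i, ∑ j ∈ Finset.Ioi i, ∑ q, centredScore θ q (ω i) * centredScore θ q (ω j))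
        + β * ∑ i, ∑ q, θ q.2 q.1 * centredScore θ q (ω i)) ^ 2
      ≤ 2 * α ^ 2 * (∑ i, ∑ j ∈ Finset.Ioi i, ∑ q,
          centredScore θ q (ω i) * centredScore θ q (ω j)) ^ 2
        + 2 * β ^ 2 * (∑ i, ∑ q, θ q.2 q.1 * centredScore θ q (ω i)) ^ 2 := fun ω => by
    refine (add_sq_le).trans_eq ?_
    ring
  have hi := (q1.const_mul (2 * α ^ 2)).add (l1.const_mul (2 * β ^ 2))
  have hf : Integrable (fun ω : Fin n → (Fin d → Fin d → ℝ) × ℝ =>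
      (α * (∑ i, ∑ j ∈ Finset.Ioi i, ∑ q, centredScore θ q (ω i) * centredScore θ q (ω j))
        + β * ∑ i, ∑ q, θ q.2 q.1 * centredScore θ q (ω i)) ^ 2)
      (Measure.pi fun _ : Fin n => rowLaw d) := by
    refine hi.mono' ?_ (ae_of_all _ fun ω => ?_)
    · refine Measurable.aestronglyMeasurable ?_
      unfold centredScore; fun_prop
    · rw [Real.norm_of_nonneg (sq_nonneg _)]; exact hb ω
  refine ⟨hf, (integral_mono hf hi hb).trans ?_⟩
  simp only [Pi.add_apply]
  rw [integral_add (q1.const_mul _) (l1.const_mul _), integral_const_mul, integral_const_mul,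
    l2, q2]
  have e1 : 2 * α ^ 2 * ((n : ℝ) * (n - 1) / 2 * ((1 + s) ^ 2 * d ^ 2 + 2 * (1 + s) * s + s ^ 2))
      = 4 * ((1 + s) ^ 2 * d ^ 2 + 2 * (1 + s) * s + s ^ 2) / (n * (n - 1)) := by
    rw [hα]
    have : (n : ℝ) - 1 ≠ 0 := by linarith
    field_simp
    ring
  have e2 : 2 * β ^ 2 * (n * ((1 + s) * s + s ^ 2)) ≤ 16 * (s + s ^ 2) / n := by
    rw [hβ, show 2 * (2 / (n : ℝ)) ^ 2 * (n * ((1 + s) * s + s ^ 2))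
      = 8 * (s + 2 * s ^ 2) / n by field_simp; ring]
    exact div_le_div_of_nonneg_right (by nlinarith) (by positivity)
  rw [e1]
  refine add_le_add ?_ e2
  rw [div_le_div_iff₀ (by nlinarith) (by positivity)]
  have e3 : 4 * ((1 + s) ^ 2 * (d : ℝ) ^ 2 + 2 * (1 + s) * s + s ^ 2)
      ≤ 16 * ((1 + s) ^ 2 * (d : ℝ) ^ 2) := by
    nlinarith [mul_le_mul_of_nonneg_left hd' (sq_nonneg (1 + s))]
  have e4 : (n : ℝ) ^ 2 ≤ 2 * (n * (n - 1)) := by nlinarith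
  calc _ ≤ 16 * ((1 + s) ^ 2 * (d : ℝ) ^ 2) * (2 * (n * (n - 1))) :=
        mul_le_mul e3 e4 (by positivity) (by positivity)
    _ = _ := by ring

end

/-! ### Total error of the explicit tests -/

noncomputable section

variable {n d : ℕ}

/-- The Cauchy-Schwarz inequality over the nonzero singular values, of which there are
`rank θ`. -/
theorem nuclearNorm_sq_le {k : ℕ} (θ : Matrix (Fin d) (Fin d) ℝ) (hk : θ.rank ≤ k) :
    nuclearNorm θ ^ 2 ≤ k * frobSq θ := by
  set hA := Matrix.isHermitian_conjTranspose_mul_self θ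
  have h0 (j : Fin d) : 0 ≤ hA.eigenvalues j :=
    (Matrix.posSemidef_conjTranspose_mul_self θ).eigenvalues_nonneg j
  have h1 : (Finset.univ.filter fun j => hA.eigenvalues j ≠ 0).card ≤ k := by
    rw [← Fintype.card_subtype, ← hA.rank_eq_card_non_zero_eigs,
      Matrix.rank_conjTranspose_mul_self]
    exact hk
  have h2 : ∑ j, hA.eigenvalues j = frobSq θ := by
    rw [← trace_transpose_mul_self, ← Matrix.conjTranspose_eq_transpose_of_trivial,
      hA.trace_eq_sum_eigenvalues]
    simp
  have h3 : nuclearNorm θ = ∑ j ∈ Finset.univ.filter (fun j => hA.eigenvalues j ≠ 0),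
      √(hA.eigenvalues j) := by
    rw [nuclearNorm, Finset.sum_filter_of_ne]
    intro j _ hj h
    exact hj (by rw [h, Real.sqrt_zero])
  rw [h3]
  refine (sq_sum_le_card_mul_sum_sq).trans ?_
  refine mul_le_mul (by exact_mod_cast h1) ?_ (Finset.sum_nonneg fun j _ => sq_nonneg _)
    (by positivity)
  simp_rw [Real.sq_sqrt (h0 _)]
  rw [← h2]
  exact Finset.sum_le_sum_of_subset_of_nonneg (Finset.subset_univ _) fun j _ _ => h0 j

theorem min_sqrt_rpow_sq (n d : ℕ) :
    (min (√((d : ℝ) / n)) ((n : ℝ) ^ (-(1 / 4) : ℝ))) ^ 2 = min ((d : ℝ) / n) (1 / √(n : ℝ)) := by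
  have h : ((n : ℝ) ^ (-(1 / 4) : ℝ)) ^ 2 = 1 / √(n : ℝ) := by
    rw [Real.rpow_neg (by positivity), inv_pow, ← Real.rpow_natCast, ← Real.rpow_mul (by positivity),
      Real.sqrt_eq_rpow]
    norm_num
  have h' : (√((d : ℝ) / n)) ^ 2 = (d : ℝ) / n := Real.sq_sqrt (by positivity)
  rcases le_total (√((d : ℝ) / n)) ((n : ℝ) ^ (-(1 / 4) : ℝ)) with hle | hle
  · rw [min_eq_left hle, h', min_eq_left]
    rw [← h, ← h']; gcongr
  · rw [min_eq_right hle, h, min_eq_right]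
    rw [← h, ← h']; gcongr

theorem rate_nuclear_eq (n d k : ℕ) :
    NormKind.nuclear.rate n d k = √(k : ℝ) * NormKind.frobenius.rate n d k := by
  simp only [NormKind.rate]
  rw [mul_min_of_nonneg _ _ (Real.sqrt_nonneg _), ← Real.sqrt_mul (by positivity),
    Real.rpow_neg (by positivity), mul_div_assoc, div_eq_mul_inv (√(k : ℝ))]

theorem rate_frobenius_sq (n d k : ℕ) :
    NormKind.frobenius.rate n d k ^ 2 = min ((d : ℝ) / n) (1 / √(n : ℝ)) := min_sqrt_rpow_sq n d

theorem rate_frobenius_nonneg (n d k : ℕ) : 0 ≤ NormKind.frobenius.rate n d k := by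
  simp only [NormKind.rate]; positivity

/-- Both kinds of separation force separation in squared Frobenius norm. -/
theorem le_frobSq_of_mem_alternative (N : NormKind) {k : ℕ} (hk : 1 ≤ k) {D ρ : ℝ} (hD : 0 ≤ D)
    (hρ : D * N.rate n d k ≤ ρ) {θ : Matrix (Fin d) (Fin d) ℝ} (hθ : θ ∈ alternative N d k ρ) :
    D ^ 2 * min ((d : ℝ) / n) (1 / √(n : ℝ)) ≤ frobSq θ := by
  obtain ⟨h1, h2⟩ := hθ
  rw [← rate_frobenius_sq n d k, ← mul_pow]
  have hr := rate_frobenius_nonneg n d k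
  cases N with
  | frobenius =>
    rw [← frobeniusNorm_sq]
    exact pow_le_pow_left₀ (by positivity) (hρ.trans h2) 2
  | nuclear =>
    have hk' : (0 : ℝ) < k := by exact_mod_cast hk
    have h3 := nuclearNorm_sq_le θ h1
    have h4 : D * (√(k : ℝ) * NormKind.frobenius.rate n d k) ≤ nuclearNorm θ := by
      rw [← rate_nuclear_eq]; exact hρ.trans h2
    have h5 := (pow_le_pow_left₀ (by positivity) h4 2).trans h3
    rw [mul_pow, mul_pow, Real.sq_sqrt hk'.le] at h5
    rw [mul_pow]
    nlinarith

theorem law_zero_explicitTest_le (hn : 2 ≤ n) (hd : 1 ≤ d) {c : ℝ} (hc : 0 < c) :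
    law n (0 : Matrix (Fin d) (Fin d) ℝ) (explicitTest n d c) ≤ ENNReal.ofReal (32 / c ^ 2) := by
  have hn' : (0 : ℝ) < n := by positivity
  have hd' : (0 : ℝ) < d := by exact_mod_cast hd
  have h0 : frobSq (0 : Matrix (Fin d) (Fin d) ℝ) = 0 := by simp [frobSq]
  rw [law_apply _ (measurableSet_explicitTest c)]
  unfold explicitTest
  split_ifs with h
  · obtain ⟨h1, h2⟩ := chiSquareStat_second_moment (n := n) (by omega)
      (0 : Matrix (Fin d) (Fin d) ℝ)
    refine (measure_le_of_integral_sq h1 h2.le (t := c * (1 / √(n : ℝ))) (by positivity)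
      fun ω hω => ?_).trans (ENNReal.ofReal_le_ofReal ?_)
    · rw [h0, sub_zero]
      exact le_trans hω (le_abs_self _)
    · rw [h0, mul_pow, div_pow, Real.sq_sqrt hn'.le]
      have : 2 * (1 + 0) ^ 2 / (n : ℝ) / (c ^ 2 * (1 ^ 2 / n)) = 2 / c ^ 2 := by field_simp; norm_num
      rw [this]; gcongr; norm_num
  · obtain ⟨h1, h2⟩ := uStat_second_moment hn hd (0 : Matrix (Fin d) (Fin d) ℝ)
    refine (measure_le_of_integral_sq h1 h2 (t := c * ((d : ℝ) / n)) (by positivity)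
      fun ω hω => ?_).trans (ENNReal.ofReal_le_ofReal ?_)
    · rw [h0, sub_zero]
      exact le_trans hω (le_abs_self _)
    · rw [h0]
      refine le_of_eq ?_
      field_simp; norm_num

theorem law_explicitTest_compl_le (hn : 2 ≤ n) (hd : 1 ≤ d) {c D : ℝ} (hD : 1 ≤ D)
    (hcD : 2 * c ≤ D ^ 2) {θ : Matrix (Fin d) (Fin d) ℝ}
    (hθ : D ^ 2 * min ((d : ℝ) / n) (1 / √(n : ℝ)) ≤ frobSq θ) :
    law n θ (explicitTest n d c)ᶜ ≤ ENNReal.ofReal (320 / D ^ 2 + 320 / n) := by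
  have hn' : (0 : ℝ) < n := by positivity
  have hd' : (1 : ℝ) ≤ d := by exact_mod_cast hd
  have hsn : 0 < √(n : ℝ) := Real.sqrt_pos.2 hn'
  have hsq : √(n : ℝ) * √(n : ℝ) = n := Real.mul_self_sqrt hn'.le
  have hD2 : 1 ≤ D ^ 2 := one_le_pow₀ hD
  rw [law_apply _ (measurableSet_explicitTest c).compl]
  set s := frobSq θ with hs
  have hpos : 0 < s := lt_of_lt_of_le (by positivity) hθ
  have hsplit : (1 + s) ^ 2 ≤ 2 + 2 * s ^ 2 := by nlinarith [sq_nonneg (1 - s)]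
  unfold explicitTest
  split_ifs with h
  · have h' : (n : ℝ) < (d : ℝ) ^ 2 := by exact_mod_cast h
    have hle : 1 / √(n : ℝ) ≤ (d : ℝ) / n := by
      rw [div_le_div_iff₀ hsn hn', one_mul]
      have : √(n : ℝ) ≤ d := Real.sqrt_le_iff.2 ⟨by positivity, h'.le⟩
      nlinarith
    rw [min_eq_right hle] at hθ
    obtain ⟨h1, h2⟩ := chiSquareStat_second_moment (n := n) (by omega) θ
    refine (measure_le_of_integral_sq h1 h2.le (t := s / 2) (by positivity)
      fun ω hω => ?_).trans (ENNReal.ofReal_le_ofReal ?_)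
    · have hω' : chiSquareStat (observeRows θ ω) < c * (1 / √(n : ℝ)) := not_le.1 hω
      have : 2 * (c * (1 / √(n : ℝ))) ≤ s := by
        refine le_trans ?_ hθ
        rw [← mul_assoc]; gcongr
      rw [abs_sub_comm]
      exact le_trans (by linarith) (le_abs_self _)
    · have h3 : D ^ 2 ≤ n * s ^ 2 := by
        have : D ^ 2 ≤ √(n : ℝ) * s := by
          rw [mul_one_div, div_le_iff₀ hsn] at hθ; linarith
        calc D ^ 2 ≤ D ^ 2 * D ^ 2 := by nlinarith
          _ ≤ (√(n : ℝ) * s) * (√(n : ℝ) * s) := by gcongr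
          _ = (√(n : ℝ) * √(n : ℝ)) * s ^ 2 := by ring
          _ = n * s ^ 2 := by rw [hsq]
      calc 2 * (1 + s) ^ 2 / n / (s / 2) ^ 2 = 8 * (1 + s) ^ 2 / (n * s ^ 2) := by
            field_simp; norm_num
        _ ≤ 8 * (2 + 2 * s ^ 2) / (n * s ^ 2) := by gcongr
        _ = 16 / (n * s ^ 2) + 16 / n := by field_simp; norm_num
        _ ≤ 320 / D ^ 2 + 320 / n := by gcongr <;> norm_num
  · have h' : (d : ℝ) ^ 2 ≤ n := by exact_mod_cast not_lt.1 h
    have hle : (d : ℝ) / n ≤ 1 / √(n : ℝ) := by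
      rw [div_le_div_iff₀ hn' hsn, one_mul]
      have : (d : ℝ) ≤ √(n : ℝ) := Real.le_sqrt_of_sq_le h'
      nlinarith
    rw [min_eq_left hle] at hθ
    obtain ⟨h1, h2⟩ := uStat_second_moment hn hd θ
    refine (measure_le_of_integral_sq h1 h2 (t := s / 2) (by positivity)
      fun ω hω => ?_).trans (ENNReal.ofReal_le_ofReal ?_)
    · have hω' : uStat (observeRows θ ω) < c * ((d : ℝ) / n) := not_le.1 hω
      have : 2 * (c * ((d : ℝ) / n)) ≤ s := by
        refine le_trans ?_ hθ
        rw [← mul_assoc]; gcongr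
      rw [abs_sub_comm]
      exact le_trans (by linarith) (le_abs_self _)
    · have h3 : D ^ 2 * d ≤ n * s := by
        rw [← mul_div_assoc, div_le_iff₀ hn'] at hθ; linarith
      have h4 : (d : ℝ) ^ 2 / (n * s) ^ 2 ≤ 1 / D ^ 2 := by
        rw [div_le_div_iff₀ (by positivity) (by positivity), one_mul]
        calc (d : ℝ) ^ 2 * D ^ 2 ≤ (D ^ 2 * d) * (D ^ 2 * d) := by
              nlinarith [mul_nonneg (mul_nonneg (sq_nonneg (d : ℝ)) (sq_nonneg D))
                (sub_nonneg.2 hD2)]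
          _ ≤ (n * s) * (n * s) := by gcongr
          _ = _ := by ring
      have h5 : (d : ℝ) ^ 2 / n ^ 2 ≤ 1 / n := by
        rw [div_le_div_iff₀ (by positivity) hn']; nlinarith
      have h6 : 1 / (n * s) ≤ 1 / D ^ 2 := by
        refine one_div_le_one_div_of_le (by positivity) (le_trans ?_ h3)
        nlinarith
      have h7 : (32 * (1 + s) ^ 2 * d ^ 2 / n ^ 2 + 16 * (s + s ^ 2) / n) / (s / 2) ^ 2
          = 128 * ((1 + s) ^ 2 * (d ^ 2 / (n * s) ^ 2)) + 64 * (1 / (n * s)) + 64 * (1 / n) := by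
        field_simp; ring
      have h8 : (1 + s) ^ 2 * ((d : ℝ) ^ 2 / (n * s) ^ 2)
          ≤ 2 * (d ^ 2 / (n * s) ^ 2) + 2 * (d ^ 2 / n ^ 2) := by
        calc _ ≤ (2 + 2 * s ^ 2) * ((d : ℝ) ^ 2 / (n * s) ^ 2) := by gcongr
          _ = _ := by field_simp
      rw [h7, ← mul_one_div 320 (D ^ 2), ← mul_one_div 320 (n : ℝ)]
      linarith

theorem exists_explicitTest_risk_le (N : NormKind) {α : ℝ} (hα : 0 < α) :
    ∃ (c D : ℝ) (n₀ : ℕ), 0 < D ∧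
      ∀ n d k : ℕ, n₀ ≤ n → 1 ≤ k → k ≤ d → ∀ ρ : ℝ, D * N.rate n d k ≤ ρ →
        MeasurableSet (explicitTest n d c) ∧
        testRisk N k ρ (explicitTest n d c) ≤ ENNReal.ofReal α := by
  have hsα : 0 < √α := Real.sqrt_pos.2 hα
  -- `32 / c² = α / 2`; each summand of `D` secures one lower bound on `D²`, as `D ≤ D²`
  set c : ℝ := 8 / √α with hc
  have hc0 : 0 < c := by positivity
  set D : ℝ := 1 + 2 * c + 1280 / α with hD
  have h1280 : 0 < 1280 / α := by positivity
  have hD1 : 1 ≤ D := by linarith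
  have hDD : D ≤ D ^ 2 := by nlinarith
  refine ⟨c, D, max 2 ⌈1280 / α⌉₊, by linarith, fun n d k hn hk hkd ρ hρ =>
    ⟨measurableSet_explicitTest c, ?_⟩⟩
  have hn2 : 2 ≤ n := (le_max_left _ _).trans hn
  have hn3 : 1280 / α ≤ n := (Nat.le_ceil _).trans (by exact_mod_cast (le_max_right _ _).trans hn)
  have b1 : 32 / c ^ 2 = α / 2 := by
    rw [hc, div_pow, Real.sq_sqrt hα.le]; field_simp; norm_num
  have b2 {x : ℝ} (hx : 1280 / α ≤ x) : 320 / x ≤ α / 4 := by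
    have hx0 : 0 < x := lt_of_lt_of_le (by positivity) hx
    rw [div_le_iff₀ hα] at hx
    rw [div_le_iff₀ hx0]; linarith
  have b3 : 320 / D ^ 2 + 320 / n ≤ α / 2 := by
    linarith [b2 hn3, b2 (show 1280 / α ≤ D ^ 2 by linarith)]
  calc testRisk N k ρ (explicitTest n d c)
      ≤ ENNReal.ofReal (α / 2) + ENNReal.ofReal (α / 2) := by
        refine add_le_add ?_ (iSup₂_le fun θ hθ => ?_)
        · rw [← b1]; exact law_zero_explicitTest_le hn2 (hk.trans hkd) hc0
        · exact (law_explicitTest_compl_le hn2 (hk.trans hkd) hD1 (by linarith)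
            (le_frobSq_of_mem_alternative N hk (by linarith) hρ hθ)).trans
            (ENNReal.ofReal_le_ofReal b3)
    _ = ENNReal.ofReal α := by
        rw [← ENNReal.ofReal_add (by positivity) (by positivity), add_halves]

end

/-! ### Likelihood ratios and Le Cam's method -/

noncomputable section

variable {n d : ℕ}

/-- A product of measures with densities has the product of the densities as density. -/
theorem pi_withDensity {Ω : Type*} [MeasurableSpace Ω] {P : Measure Ω} [IsProbabilityMeasure P]
    {f : Ω → ℝ≥0∞} (hf : Measurable f) [SigmaFinite (P.withDensity f)] (n : ℕ) :
    Measure.pi (fun _ : Fin n => P.withDensity f)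
      = (Measure.pi fun _ : Fin n => P).withDensity fun ω => ∏ i, f (ω i) := by
  refine Measure.pi_eq fun s hs => ?_
  rw [withDensity_apply _ (MeasurableSet.univ_pi hs), ← lintegral_indicator (MeasurableSet.univ_pi hs)]
  have e (ω : Fin n → Ω) : (Set.univ.pi s).indicator (fun ω => ∏ i, f (ω i)) ω
      = ∏ i, (s i).indicator f (ω i) := by
    by_cases h : ∀ i, ω i ∈ s i
    · rw [Set.indicator_of_mem (by simpa [Set.mem_pi] using h)]
      exact Finset.prod_congr rfl fun i _ => (Set.indicator_of_mem (h i) _).symm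
    · rw [Set.indicator_of_notMem (by simpa [Set.mem_pi] using h)]
      push Not at h
      obtain ⟨i, hi⟩ := h
      exact (Finset.prod_eq_zero (Finset.mem_univ i) (Set.indicator_of_notMem hi _)).symm
  simp_rw [e]
  have hind : iIndepFun (fun i (ω : Fin n → Ω) => (s i).indicator f (ω i))
      (Measure.pi fun _ => P) :=
    iIndepFun_pi (X := fun i => (s i).indicator f) fun i => (hf.indicator (hs i)).aemeasurable
  rw [lintegral_prod_eq_prod_lintegral_of_indepFun _ _ hind
    fun i => (hf.indicator (hs i)).comp (measurable_pi_apply i)]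
  refine Finset.prod_congr rfl fun i _ => ?_
  have hmp := measurePreserving_eval (fun _ : Fin n => P) i
  rw [withDensity_apply _ (hs i), ← lintegral_indicator (hs i)]
  exact hmp.lintegral_comp (hf.indicator (hs i))

/-- The Cameron-Martin formula on the line. -/
theorem lintegral_gaussian_shift (m : ℝ) {f : ℝ → ℝ≥0∞} (hf : Measurable f) :
    ∫⁻ e, f (m + e) ∂(gaussianReal 0 1)
      = ∫⁻ e, ENNReal.ofReal (Real.exp (m * e - m ^ 2 / 2)) * f e ∂(gaussianReal 0 1) := by
  have h : (gaussianReal 0 1).map (m + ·) = gaussianReal m 1 := by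
    rw [gaussianReal_map_const_add]; simp
  rw [← lintegral_map hf (by fun_prop), h, gaussianReal_of_var_ne_zero _ one_ne_zero,
    gaussianReal_of_var_ne_zero _ one_ne_zero,
    lintegral_withDensity_eq_lintegral_mul _ (measurable_gaussianPDF _ _) hf,
    lintegral_withDensity_eq_lintegral_mul _ (measurable_gaussianPDF _ _) (by fun_prop)]
  refine lintegral_congr fun e => ?_
  simp only [Pi.mul_apply, ← mul_assoc]
  rw [gaussianPDF_def, gaussianPDF_def, ← ENNReal.ofReal_mul (gaussianPDFReal_nonneg _ _ _)]
  congr 1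
  simp only [gaussianPDFReal_def, mul_assoc, ← Real.exp_add, NNReal.coe_one, mul_one]
  ring_nf

theorem lintegral_exp_gaussian (b c : ℝ) :
    ∫⁻ e, ENNReal.ofReal (Real.exp (b * e - c)) ∂(gaussianReal 0 1)
      = ENNReal.ofReal (Real.exp (b ^ 2 / 2 - c)) := by
  have hi : Integrable (fun e => Real.exp (b * e - c)) (gaussianReal 0 1) := by
    simp_rw [Real.exp_sub]
    exact (integrable_exp_mul_gaussianReal b).div_const _
  rw [← ofReal_integral_eq_lintegral_ofReal hi (ae_of_all _ fun _ => (Real.exp_pos _).le)]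
  congr 1
  have h := congrFun (mgf_id_gaussianReal (μ := 0) (v := 1)) b
  simp only [mgf, id, zero_mul, NNReal.coe_one, one_mul, zero_add] at h
  simp_rw [Real.exp_sub]
  rw [integral_div, h]

/-- The noiseless response `tr (x θ)` of a row. -/
def signal (θ : Matrix (Fin d) (Fin d) ℝ) (x : Fin d → Fin d → ℝ) : ℝ :=
  ∑ q : Fin d × Fin d, θ q.2 q.1 * x q.1 q.2

@[fun_prop]
theorem measurable_signal (θ : Matrix (Fin d) (Fin d) ℝ) : Measurable (signal θ) := by
  unfold signal; fun_prop

theorem response_eq_signal_add (θ : Matrix (Fin d) (Fin d) ℝ) (w : (Fin d → Fin d → ℝ) × ℝ) :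
    response θ w = signal θ w.1 + w.2 := by
  simp [response, responseCoeff, rowCoord, Fintype.sum_option, signal, add_comm]

theorem response_zero (w : (Fin d → Fin d → ℝ) × ℝ) :
    response (0 : Matrix (Fin d) (Fin d) ℝ) w = w.2 := by
  simp [response_eq_signal_add, signal]

/-- Likelihood ratio of a single observation, as a function of `(x, y)`. -/
def rowLikelihood (θ : Matrix (Fin d) (Fin d) ℝ) (w : (Fin d → Fin d → ℝ) × ℝ) : ℝ :=
  Real.exp (signal θ w.1 * w.2 - signal θ w.1 ^ 2 / 2)

theorem rowLikelihood_pos (θ : Matrix (Fin d) (Fin d) ℝ) (w : (Fin d → Fin d → ℝ) × ℝ) :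
    0 < rowLikelihood θ w := Real.exp_pos _

@[fun_prop]
theorem measurable_rowLikelihood (θ : Matrix (Fin d) (Fin d) ℝ) :
    Measurable (rowLikelihood θ) := by
  unfold rowLikelihood; fun_prop

/-- `rowLikelihood θ` is the density of the law of `(x, y)` under `θ` with respect to the law under
`0`, under which `y` is the noise; so the law under `0` is `rowLaw` itself. -/
theorem rowLaw_map_response (θ : Matrix (Fin d) (Fin d) ℝ) :
    (rowLaw d).map (fun w => (w.1, response θ w))
      = (rowLaw d).withDensity fun w => ENNReal.ofReal (rowLikelihood θ w) := by
  refine Measure.ext_of_lintegral _ fun f hf => ?_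
  rw [lintegral_map hf (by fun_prop), lintegral_withDensity_eq_lintegral_mul _ (by fun_prop) hf]
  simp_rw [response_eq_signal_add]
  unfold rowLaw
  rw [lintegral_prod _ (by fun_prop), lintegral_prod _ (by fun_prop)]
  refine lintegral_congr fun x => ?_
  exact lintegral_gaussian_shift (signal θ x) (f := fun e => f (x, e)) (by fun_prop)

/-- Likelihood ratio of the whole sample. -/
def likelihood (θ : Matrix (Fin d) (Fin d) ℝ) (ω : Fin n → (Fin d → Fin d → ℝ) × ℝ) : ℝ :=
  ∏ i, rowLikelihood θ (ω i)

theorem likelihood_pos (θ : Matrix (Fin d) (Fin d) ℝ) (ω : Fin n → (Fin d → Fin d → ℝ) × ℝ) :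
    0 < likelihood θ ω := Finset.prod_pos fun _ _ => rowLikelihood_pos _ _

@[fun_prop]
theorem measurable_likelihood (θ : Matrix (Fin d) (Fin d) ℝ) :
    Measurable (likelihood (n := n) θ) := by
  unfold likelihood; fun_prop

theorem law_apply_eq_lintegral (θ : Matrix (Fin d) (Fin d) ℝ) {A : Set (Observation n d)}
    (hA : MeasurableSet A) :
    law n θ A = ∫⁻ ω in {ω | observeRows (0 : Matrix (Fin d) (Fin d) ℝ) ω ∈ A},
      ENNReal.ofReal (likelihood θ ω) ∂(Measure.pi fun _ : Fin n => rowLaw d) := by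
  have hT : Measurable fun w : (Fin d → Fin d → ℝ) × ℝ => (w.1, response θ w) := by fun_prop
  have hP := Measure.isProbabilityMeasure_map (μ := rowLaw d) hT.aemeasurable
  have hB : MeasurableSet {ω : Fin n → (Fin d → Fin d → ℝ) × ℝ |
      observeRows (0 : Matrix (Fin d) (Fin d) ℝ) ω ∈ A} := measurable_observeRows 0 hA
  have e : observeRows (n := n) θ = observeRows (0 : Matrix (Fin d) (Fin d) ℝ) ∘
      fun (ω : Fin n → (Fin d → Fin d → ℝ) × ℝ) i => ((ω i).1, response θ (ω i)) := by
    ext1 ω; simp [observeRows, response_zero]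
  have hmap : (Measure.pi fun _ : Fin n => rowLaw d).map
      (fun (ω : Fin n → (Fin d → Fin d → ℝ) × ℝ) i => ((ω i).1, response θ (ω i)))
      = Measure.pi fun _ : Fin n => (rowLaw d).map fun w => (w.1, response θ w) :=
    Measure.pi_map_pi (μ := fun _ : Fin n => rowLaw d)
      (f := fun _ w => (w.1, response θ w)) fun _ => hT.aemeasurable
  rw [law_eq_map, e, ← Measure.map_map (measurable_observeRows 0)
    (measurable_pi_lambda _ fun i => by fun_prop), hmap,
    Measure.map_apply (measurable_observeRows 0) hA]
  rw [rowLaw_map_response] at hP ⊢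
  rw [pi_withDensity (by fun_prop), withDensity_apply _ (by exact hB)]
  refine lintegral_congr fun ω => ?_
  rw [likelihood, ENNReal.ofReal_prod_of_nonneg fun i _ => (rowLikelihood_pos _ _).le]

theorem integrable_likelihood (θ : Matrix (Fin d) (Fin d) ℝ) :
    Integrable (likelihood θ) (Measure.pi fun _ : Fin n => rowLaw d) ∧
    ∫ ω, likelihood θ ω ∂(Measure.pi fun _ : Fin n => rowLaw d) = 1 := by
  have h := law_apply_eq_lintegral (n := n) θ MeasurableSet.univ
  simp only [measure_univ, Set.mem_univ, Set.ofPred_true, Measure.restrict_univ] at h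
  have hnn : 0 ≤ᵐ[Measure.pi fun _ : Fin n => rowLaw d] likelihood θ :=
    ae_of_all _ fun ω => (likelihood_pos θ ω).le
  refine ⟨⟨by fun_prop, ?_⟩, ?_⟩
  · rw [hasFiniteIntegral_iff_ofReal hnn, ← h]; simp
  · rw [integral_eq_lintegral_of_nonneg_ae hnn (by fun_prop), ← h]; simp

theorem law_real_eq_setIntegral (θ : Matrix (Fin d) (Fin d) ℝ) {A : Set (Observation n d)}
    (hA : MeasurableSet A) :
    (law n θ).real A = ∫ ω in {ω | observeRows (0 : Matrix (Fin d) (Fin d) ℝ) ω ∈ A},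
      likelihood θ ω ∂(Measure.pi fun _ : Fin n => rowLaw d) := by
  rw [Measure.real, law_apply_eq_lintegral θ hA, integral_eq_lintegral_of_nonneg_ae
    (ae_of_all _ fun ω => (likelihood_pos θ ω).le) (by fun_prop)]


/-- Integrates out the noise for a fixed design. -/
theorem lintegral_rowLikelihood_mul (θ θ' : Matrix (Fin d) (Fin d) ℝ) :
    ∫⁻ w, ENNReal.ofReal (rowLikelihood θ w * rowLikelihood θ' w) ∂(rowLaw d)
      = ∫⁻ w, ENNReal.ofReal (Real.exp (signal θ w.1 * signal θ' w.1)) ∂(rowLaw d) := by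
  unfold rowLaw rowLikelihood
  rw [lintegral_prod _ (by fun_prop), lintegral_prod _ (by fun_prop)]
  refine lintegral_congr fun x => ?_
  simp only [lintegral_const, measure_univ, mul_one]
  have h := lintegral_exp_gaussian (signal θ x + signal θ' x)
    (signal θ x ^ 2 / 2 + signal θ' x ^ 2 / 2)
  convert h using 3
  · rw [← Real.exp_add]; ring_nf
  · ring_nf

theorem hasLaw_signal (θ : Matrix (Fin d) (Fin d) ℝ) :
    HasLaw (fun w : (Fin d → Fin d → ℝ) × ℝ => signal θ w.1)
      (gaussianReal 0 (frobSq θ).toNNReal) (rowLaw d) := by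
  have h := isStdGaussian_rowCoord d fun q => q.elim 0 fun q => θ q.2 q.1
  simpa [Fintype.sum_option, rowCoord, frobSq, signal] using h

/-- The inner product `tr (θᵀ θ')`. -/
def frobInner (θ θ' : Matrix (Fin d) (Fin d) ℝ) : ℝ := ∑ q : Fin d × Fin d, θ q.2 q.1 * θ' q.2 q.1

theorem frobSq_add (θ θ' : Matrix (Fin d) (Fin d) ℝ) :
    frobSq (θ + θ') = frobSq θ + frobSq θ' + 2 * frobInner θ θ' := by
  simp only [frobSq, frobInner, Finset.mul_sum, ← Finset.sum_add_distrib, Matrix.add_apply]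
  exact Finset.sum_congr rfl fun q _ => by ring

theorem frobSq_sub (θ θ' : Matrix (Fin d) (Fin d) ℝ) :
    frobSq (θ - θ') = frobSq θ + frobSq θ' - 2 * frobInner θ θ' := by
  simp only [frobSq, frobInner, Finset.mul_sum, ← Finset.sum_add_distrib, Matrix.sub_apply,
    ← Finset.sum_sub_distrib]
  exact Finset.sum_congr rfl fun q _ => by ring

/-- Second moment of the likelihood ratios. The product `⟨x, θ⟩ ⟨x, θ'⟩` is the difference of the
squares of two Gaussian variables, whose exponential moments are separated by the weighted
inequality between arithmetic and geometric means. -/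
theorem rowLikelihood_second_moment {s : ℝ} (hs : s ≤ 1 / 8) {θ θ' : Matrix (Fin d) (Fin d) ℝ}
    (h : frobSq θ = s) (h' : frobSq θ' = s) :
    Integrable (fun w => rowLikelihood θ w * rowLikelihood θ' w) (rowLaw d) ∧
    ∫ w, rowLikelihood θ w * rowLikelihood θ' w ∂(rowLaw d)
      ≤ Real.exp (frobInner θ θ' + 4 * s ^ 2) := by
  set t := frobInner θ θ' with ht
  have p1 : frobSq (θ + θ') = 2 * (s + t) := by rw [frobSq_add, h, h', ← ht]; ring
  have p2 : frobSq (θ - θ') = 2 * (s - t) := by rw [frobSq_sub, h, h', ← ht]; ring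
  have n1 := frobSq_nonneg (θ + θ')
  have n2 := frobSq_nonneg (θ - θ')
  have l1 := hasLaw_signal (θ + θ')
  have l2 := hasLaw_signal (θ - θ')
  rw [p1] at n1 l1
  rw [p2] at n2 l2
  have hts : t ^ 2 ≤ s ^ 2 := by nlinarith
  have i1 := integrable_exp_sq_of_hasLaw n1 l1 (c := 1) (by linarith)
  have i2 := integrable_exp_sq_of_hasLaw n2 l2 (c := -1) (by linarith)
  have b1 : ∫ w, Real.exp (1 * signal (θ + θ') w.1 ^ 2 / 2) ∂(rowLaw d)
      ≤ Real.exp ((s + t) + 2 * (s + t) ^ 2) := by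
    rw [integral_exp_sq_of_hasLaw n1 l1]
    refine (inv_sqrt_one_sub_le (abs_le.2 ⟨by linarith, by linarith⟩)).trans_eq ?_
    ring_nf
  have b2 : ∫ w, Real.exp (-1 * signal (θ - θ') w.1 ^ 2 / 2) ∂(rowLaw d)
      ≤ Real.exp (-(s - t) + 2 * (s - t) ^ 2) := by
    rw [integral_exp_sq_of_hasLaw n2 l2]
    refine (inv_sqrt_one_sub_le (abs_le.2 ⟨by linarith, by linarith⟩)).trans_eq ?_
    ring_nf
  set α := (s + t) + 2 * (s + t) ^ 2
  set β := -(s - t) + 2 * (s - t) ^ 2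
  have hαβ : (α + β) / 2 ≤ t + 4 * s ^ 2 := by simp only [α, β]; nlinarith
  -- the weight `exp ((β - α) / 2)` balances the two exponential moments
  have hb (w : (Fin d → Fin d → ℝ) × ℝ) : Real.exp (signal θ w.1 * signal θ' w.1)
      ≤ Real.exp ((β - α) / 2) / 2 * Real.exp (1 * signal (θ + θ') w.1 ^ 2 / 2)
        + Real.exp ((α - β) / 2) / 2 * Real.exp (-1 * signal (θ - θ') w.1 ^ 2 / 2) := by
    have e1 : signal (θ + θ') w.1 = signal θ w.1 + signal θ' w.1 := by
      simp [signal, add_mul, Finset.sum_add_distrib]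
    have e2 : signal (θ - θ') w.1 = signal θ w.1 - signal θ' w.1 := by
      simp [signal, sub_mul, Finset.sum_sub_distrib]
    rw [e1, e2]
    set x := signal θ w.1
    set y := signal θ' w.1
    have hx : Real.exp (x * y) = Real.exp ((β - α) / 4 + (x + y) ^ 2 / 4) *
        Real.exp ((α - β) / 4 - (x - y) ^ 2 / 4) := by
      rw [← Real.exp_add]; ring_nf
    have hu : Real.exp ((β - α) / 2) * Real.exp (1 * (x + y) ^ 2 / 2)
        = Real.exp ((β - α) / 4 + (x + y) ^ 2 / 4) ^ 2 := by
      rw [← Real.exp_add, ← Real.exp_nat_mul]; push_cast; ring_nf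
    have hv : Real.exp ((α - β) / 2) * Real.exp (-1 * (x - y) ^ 2 / 2)
        = Real.exp ((α - β) / 4 - (x - y) ^ 2 / 4) ^ 2 := by
      rw [← Real.exp_add, ← Real.exp_nat_mul]; push_cast; ring_nf
    rw [hx, div_mul_eq_mul_div, div_mul_eq_mul_div, hu, hv]
    nlinarith [sq_nonneg (Real.exp ((β - α) / 4 + (x + y) ^ 2 / 4)
      - Real.exp ((α - β) / 4 - (x - y) ^ 2 / 4))]
  have hi := (i1.const_mul (Real.exp ((β - α) / 2) / 2)).add
    (i2.const_mul (Real.exp ((α - β) / 2) / 2))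
  have hE : Integrable (fun w : (Fin d → Fin d → ℝ) × ℝ =>
      Real.exp (signal θ w.1 * signal θ' w.1)) (rowLaw d) := by
    refine hi.mono' (by fun_prop) (ae_of_all _ fun w => ?_)
    rw [Real.norm_of_nonneg (Real.exp_pos _).le]; exact hb w
  have hle : ∫ w, Real.exp (signal θ w.1 * signal θ' w.1) ∂(rowLaw d)
      ≤ Real.exp (t + 4 * s ^ 2) := by
    refine (integral_mono hE hi hb).trans ?_
    simp only [Pi.add_apply]
    rw [integral_add (i1.const_mul _) (i2.const_mul _), integral_const_mul, integral_const_mul]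
    calc _ ≤ Real.exp ((β - α) / 2) / 2 * Real.exp α + Real.exp ((α - β) / 2) / 2 * Real.exp β := by
          gcongr
      _ = Real.exp ((α + β) / 2) := by
          rw [div_mul_eq_mul_div, div_mul_eq_mul_div, ← Real.exp_add, ← Real.exp_add]
          ring_nf
      _ ≤ _ := Real.exp_le_exp.2 hαβ
  have hnn (w : (Fin d → Fin d → ℝ) × ℝ) : 0 ≤ rowLikelihood θ w * rowLikelihood θ' w :=
    (mul_pos (rowLikelihood_pos _ _) (rowLikelihood_pos _ _)).le
  have hl := lintegral_rowLikelihood_mul θ θ'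
  rw [← ofReal_integral_eq_lintegral_ofReal hE (ae_of_all _ fun w => (Real.exp_pos _).le)] at hl
  refine ⟨⟨by fun_prop, ?_⟩, ?_⟩
  · rw [hasFiniteIntegral_iff_ofReal (ae_of_all _ hnn), hl]; exact ENNReal.ofReal_lt_top
  · rw [integral_eq_lintegral_of_nonneg_ae (ae_of_all _ hnn) (by fun_prop), hl,
      ENNReal.toReal_ofReal (integral_nonneg fun w => (Real.exp_pos _).le)]
    exact hle

theorem likelihood_second_moment {s : ℝ} (hs : s ≤ 1 / 8) {θ θ' : Matrix (Fin d) (Fin d) ℝ}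
    (h : frobSq θ = s) (h' : frobSq θ' = s) :
    Integrable (fun ω => likelihood θ ω * likelihood θ' ω)
      (Measure.pi fun _ : Fin n => rowLaw d) ∧
    ∫ ω, likelihood θ ω * likelihood θ' ω ∂(Measure.pi fun _ : Fin n => rowLaw d)
      ≤ Real.exp (n * frobInner θ θ' + 4 * (n * s ^ 2)) := by
  obtain ⟨h1, h2⟩ := rowLikelihood_second_moment hs h h'
  simp only [likelihood, ← Finset.prod_mul_distrib]
  refine ⟨Integrable.fintype_prod (f := fun _ w => rowLikelihood θ w * rowLikelihood θ' w)
    fun _ => h1, ?_⟩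
  rw [integral_fintype_prod_eq_pow (fun w => rowLikelihood θ w * rowLikelihood θ' w),
    Fintype.card_fin]
  refine (pow_le_pow_left₀ (integral_nonneg fun w =>
    (mul_pos (rowLikelihood_pos _ _) (rowLikelihood_pos _ _)).le) h2 n).trans_eq ?_
  rw [← Real.exp_nat_mul]; ring_nf

/-- Le Cam's second moment method: if the likelihood ratio of the uniform mixture over a finite
subset of the alternative has second moment at most `1 + ε ^ 2`, then no test beats `1 - ε`. -/
theorem le_testRisk_of_second_moment {J : Type*} [Fintype J] [Nonempty J]
    {N : NormKind} {k : ℕ} {ρ : ℝ} {θ : J → Matrix (Fin d) (Fin d) ℝ}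
    (hθ : ∀ j, θ j ∈ alternative N d k ρ) {ε : ℝ} (hε : 0 < ε)
    (hi : ∀ i j, Integrable (fun ω => likelihood (θ i) ω * likelihood (θ j) ω)
      (Measure.pi fun _ : Fin n => rowLaw d))
    (hsum : ∑ i, ∑ j, ∫ ω, likelihood (θ i) ω * likelihood (θ j) ω
      ∂(Measure.pi fun _ : Fin n => rowLaw d) ≤ (1 + ε ^ 2) * (Fintype.card J : ℝ) ^ 2)
    {A : Set (Observation n d)} (hA : MeasurableSet A) :
    ENNReal.ofReal (1 - ε) ≤ testRisk N k ρ A := by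
  set Q := Measure.pi fun _ : Fin n => rowLaw d with hQ
  set B : Set (Fin n → (Fin d → Fin d → ℝ) × ℝ) :=
    {ω | observeRows (0 : Matrix (Fin d) (Fin d) ℝ) ω ∈ Aᶜ} with hB
  set M : ℝ := (Fintype.card J : ℝ) with hM
  have hM0 : 0 < M := by rw [hM]; exact_mod_cast Fintype.card_pos
  set L : (Fin n → (Fin d → Fin d → ℝ) × ℝ) → ℝ := fun ω => M⁻¹ * ∑ j, likelihood (θ j) ω with hL
  have hLi : Integrable L Q :=
    (integrable_finsetSum _ fun j _ => (integrable_likelihood (θ j)).1).const_mul _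
  have hL1 : ∫ ω, L ω ∂Q = 1 := by
    simp only [hL]
    rw [integral_const_mul, integral_finsetSum _ fun j _ => (integrable_likelihood (θ j)).1]
    have hone (j : J) : ∫ ω, likelihood (θ j) ω ∂Q = 1 := (integrable_likelihood (θ j)).2
    rw [Finset.sum_congr rfl fun j _ => hone j]
    simp [← hM, hM0.ne']
  have eL (ω : Fin n → (Fin d → Fin d → ℝ) × ℝ) : L ω ^ 2
      = (M⁻¹) ^ 2 * ∑ i, ∑ j, likelihood (θ i) ω * likelihood (θ j) ω := by
    simp only [hL]; rw [mul_pow, sq (∑ j, _), Finset.sum_mul_sum]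
  have hL2i : Integrable (fun ω => L ω ^ 2) Q := by
    simp_rw [eL]
    exact (integrable_finsetSum _ fun i _ => integrable_finsetSum _ fun j _ => hi i j).const_mul _
  have hL2 : ∫ ω, L ω ^ 2 ∂Q ≤ 1 + ε ^ 2 := by
    simp_rw [eL]
    rw [integral_const_mul, integral_finsetSum _ fun i _ => integrable_finsetSum _ fun j _ => hi i j]
    simp_rw [integral_finsetSum _ fun j _ => hi _ j]
    calc _ ≤ (M⁻¹) ^ 2 * ((1 + ε ^ 2) * M ^ 2) := by gcongr
      _ = 1 + ε ^ 2 := by field_simp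
  -- the total variation distance between the null and the mixture
  have hkey : ∫ ω in B, (1 - L ω) ∂Q ≤ ε := by
    have i1 : Integrable (fun ω => 1 - L ω) Q := (integrable_const _).sub hLi
    have hsq : ∀ ω, (1 - L ω) ^ 2 = 1 - 2 * L ω + L ω ^ 2 := fun ω => by ring
    have i2 : Integrable (fun ω => (ε + (1 - 2 * L ω + L ω ^ 2) / ε) / 2) Q :=
      ((integrable_const _).add ((((integrable_const _).sub (hLi.const_mul 2)).add
        hL2i).div_const _)).div_const _
    have hp (ω) : 1 - L ω ≤ (ε + (1 - 2 * L ω + L ω ^ 2) / ε) / 2 := by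
      rw [← hsq, le_div_iff₀ two_pos, ← sub_nonneg]
      have : ε + (1 - L ω) ^ 2 / ε - (1 - L ω) * 2 = (ε - (1 - L ω)) ^ 2 / ε := by
        field_simp; ring
      rw [this]; positivity
    have hp0 (ω) : 0 ≤ (ε + (1 - 2 * L ω + L ω ^ 2) / ε) / 2 := by
      rw [← hsq]; positivity
    calc ∫ ω in B, (1 - L ω) ∂Q ≤ ∫ ω in B, (ε + (1 - 2 * L ω + L ω ^ 2) / ε) / 2 ∂Q :=
          integral_mono i1.integrableOn i2.integrableOn hp
      _ ≤ ∫ ω, (ε + (1 - 2 * L ω + L ω ^ 2) / ε) / 2 ∂Q :=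
          setIntegral_le_integral i2 (ae_of_all _ hp0)
      _ = (ε + (1 - 2 * 1 + ∫ ω, L ω ^ 2 ∂Q) / ε) / 2 := by
          have j1 : Integrable (fun ω => 1 - 2 * L ω) Q := (integrable_const _).sub (hLi.const_mul 2)
          rw [integral_div, integral_add (integrable_const _) (by exact (j1.add hL2i).div_const _),
            integral_div, integral_add j1 hL2i, integral_sub (integrable_const _) (hLi.const_mul 2),
            integral_const_mul, hL1]
          simp
      _ ≤ (ε + (1 - 2 * 1 + (1 + ε ^ 2)) / ε) / 2 := by gcongr
      _ = ε := by field_simp; ring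
  have hnull : (law n (0 : Matrix (Fin d) (Fin d) ℝ)).real A = 1 - Q.real B := by
    have : (law n (0 : Matrix (Fin d) (Fin d) ℝ)).real Aᶜ = Q.real B := by
      rw [Measure.real, law_apply _ hA.compl, Measure.real]
    rw [← this, probReal_compl_eq_one_sub hA]; ring
  have halt : M⁻¹ * ∑ j, (law n (θ j)).real Aᶜ = ∫ ω in B, L ω ∂Q := by
    simp only [hL]
    rw [integral_const_mul, integral_finsetSum _ fun j _ => (integrable_likelihood (θ j)).1.integrableOn]
    simp_rw [law_real_eq_setIntegral _ hA.compl]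
    rfl
  have hsub : ∫ ω in B, (1 - L ω) ∂Q = Q.real B - ∫ ω in B, L ω ∂Q := by
    rw [integral_sub (integrable_const _).integrableOn hLi.integrableOn]; simp
  -- some parameter is at least as hard as the mixture
  obtain ⟨j, hj⟩ : ∃ j, M⁻¹ * ∑ j, (law n (θ j)).real Aᶜ ≤ (law n (θ j)).real Aᶜ := by
    by_contra! H
    have := Finset.sum_lt_sum_of_nonempty (Finset.univ_nonempty (α := J)) fun j _ => H j
    rw [Finset.sum_const, Finset.card_univ, nsmul_eq_mul, ← hM, ← mul_assoc,
      mul_inv_cancel₀ hM0.ne', one_mul] at this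
    exact lt_irrefl _ this
  calc ENNReal.ofReal (1 - ε)
      ≤ ENNReal.ofReal ((law n (0 : Matrix (Fin d) (Fin d) ℝ)).real A + (law n (θ j)).real Aᶜ) :=
        ENNReal.ofReal_le_ofReal (by linarith)
    _ = law n (0 : Matrix (Fin d) (Fin d) ℝ) A + law n (θ j) Aᶜ := by
        rw [ENNReal.ofReal_add measureReal_nonneg measureReal_nonneg, ofReal_measureReal,
          ofReal_measureReal]
    _ ≤ testRisk N k ρ A := add_le_add le_rfl (le_iSup₂_of_le (θ j) (hθ j) le_rfl)

end

/-! ### Sign priors -/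

noncomputable section

variable {n d k : ℕ}

/-- The sign `±1` encoded by a Boolean. -/
def sgn (b : Bool) : ℝ := if b then 1 else -1

theorem sgn_mul_self (b : Bool) : sgn b * sgn b = 1 := by cases b <;> simp [sgn]

theorem sgn_sq (b : Bool) : sgn b ^ 2 = 1 := by rw [sq, sgn_mul_self]

/-- The inner product of two sign vectors. -/
def signInner (u u' : Fin d → Bool) : ℝ := ∑ i, sgn (u i) * sgn (u' i)

/-- Uniform signs are sub-Gaussian, because `cosh τ ≤ exp (τ² / 2)`. -/
theorem sum_exp_signInner_le (τ : ℝ) (u' : Fin d → Bool) :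
    ∑ u : Fin d → Bool, Real.exp (τ * signInner u u') ≤ 2 ^ d * Real.exp (d * τ ^ 2 / 2) := by
  have e (u : Fin d → Bool) : Real.exp (τ * signInner u u')
      = ∏ i, Real.exp (τ * (sgn (u i) * sgn (u' i))) := by
    rw [signInner, Finset.mul_sum, Real.exp_sum]
  have h : ∑ u : Fin d → Bool, Real.exp (τ * signInner u u')
      = ∏ i : Fin d, ∑ b : Bool, Real.exp (τ * (sgn b * sgn (u' i))) := by
    simp_rw [e]
    rw [Finset.prod_univ_sum, Fintype.piFinset_univ]
  have h2 (i : Fin d) : ∑ b : Bool, Real.exp (τ * (sgn b * sgn (u' i)))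
      ≤ 2 * Real.exp (τ ^ 2 / 2) := by
    have hc := Real.cosh_le_exp_half_sq τ
    rw [Real.cosh_eq] at hc
    cases u' i <;> simp [sgn] <;> linarith
  rw [h]
  calc _ ≤ ∏ _i : Fin d, 2 * Real.exp (τ ^ 2 / 2) :=
        Finset.prod_le_prod (fun i _ => Finset.sum_nonneg fun b _ => (Real.exp_pos _).le)
          fun i _ => h2 i
    _ = _ := by
        rw [Finset.prod_const, Finset.card_univ, Fintype.card_fin, mul_pow, ← Real.exp_nat_mul]
        ring_nf

/-- A Gaussian average linearises the square in the exponent. -/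
theorem sum_exp_signInner_sq_le {κ : ℝ} (hκ : 0 ≤ κ) (hd : d * κ < 1) (u' : Fin d → Bool) :
    ∑ u : Fin d → Bool, Real.exp (κ * signInner u u' ^ 2 / 2)
      ≤ 2 ^ d * (√(1 - d * κ))⁻¹ := by
  have e (x : ℝ) : Real.exp (κ * x ^ 2 / 2) = ∫ g, Real.exp ((√κ * x) * g) ∂(gaussianReal 0 1) := by
    have h := congrFun (mgf_id_gaussianReal (μ := 0) (v := 1)) (√κ * x)
    simp only [mgf, id, zero_mul, NNReal.coe_one, one_mul, zero_add] at h
    rw [h, mul_pow, Real.sq_sqrt hκ]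
  simp_rw [e]
  rw [← integral_finsetSum _ fun u _ => integrable_exp_mul_gaussianReal _,
    ← integral_exp_sq_gaussianReal, ← integral_const_mul]
  refine integral_mono (integrable_finsetSum _ fun u _ => integrable_exp_mul_gaussianReal _)
    ((integrable_exp_sq_gaussianReal hd).const_mul _) fun g => ?_
  refine le_trans (le_of_eq ?_) ((sum_exp_signInner_le (√κ * g) u').trans_eq ?_)
  · exact Finset.sum_congr rfl fun u _ => by ring_nf
  · rw [mul_pow, Real.sq_sqrt hκ, mul_assoc]

/-- The exponential moment of the overlap of two independent draws from the prior. -/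
theorem sum_exp_signInner_mul_le {c : ℝ} (hc : (d * c) ^ 2 < 1) :
    ∑ p : (Fin d → Bool) × (Fin d → Bool), ∑ p' : (Fin d → Bool) × (Fin d → Bool),
      Real.exp (c * (signInner p.1 p'.1 * signInner p.2 p'.2))
      ≤ ((4 : ℝ) ^ d) ^ 2 * (√(1 - (d * c) ^ 2))⁻¹ := by
  have hd : (d : ℝ) * (d * c ^ 2) = (d * c) ^ 2 := by ring
  have h1 (p' : (Fin d → Bool) × (Fin d → Bool)) : ∑ p : (Fin d → Bool) × (Fin d → Bool),
      Real.exp (c * (signInner p.1 p'.1 * signInner p.2 p'.2))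
      ≤ (4 : ℝ) ^ d * (√(1 - (d * c) ^ 2))⁻¹ := by
    rw [Fintype.sum_prod_type]
    calc _ ≤ ∑ u : Fin d → Bool, 2 ^ d * Real.exp (d * c ^ 2 * signInner u p'.1 ^ 2 / 2) := by
          refine Finset.sum_le_sum fun u _ => ?_
          have h := sum_exp_signInner_le (c * signInner u p'.1) p'.2
          simp_rw [mul_assoc] at h
          refine h.trans_eq ?_
          ring_nf
      _ ≤ 2 ^ d * (2 ^ d * (√(1 - d * (d * c ^ 2)))⁻¹) := by
          rw [← Finset.mul_sum]
          gcongr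
          exact sum_exp_signInner_sq_le (by positivity) (by rwa [hd]) p'.1
      _ = _ := by
          rw [hd, ← mul_assoc, ← mul_pow]; norm_num
  rw [Finset.sum_comm]
  refine (Finset.sum_le_sum fun p' _ => h1 p').trans_eq ?_
  have hcard : ((Finset.univ : Finset ((Fin d → Bool) × (Fin d → Bool))).card : ℝ) = 4 ^ d := by
    simp [← mul_pow]
  rw [Finset.sum_const, nsmul_eq_mul, hcard]; ring

/-- The matrices carrying the prior: `a` times the sign pattern `H`, with the signs of the rows and
of the columns flipped by `u` and `v`. -/
def priorMatrix (a : ℝ) (H : Fin d → Fin d → Bool) (p : (Fin d → Bool) × (Fin d → Bool)) :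
    Matrix (Fin d) (Fin d) ℝ :=
  Matrix.of fun i l => a * (sgn (p.1 i) * sgn (H i l) * sgn (p.2 l))

theorem frobInner_priorMatrix (a : ℝ) (H : Fin d → Fin d → Bool)
    (p p' : (Fin d → Bool) × (Fin d → Bool)) :
    frobInner (priorMatrix a H p) (priorMatrix a H p')
      = a ^ 2 * (signInner p.1 p'.1 * signInner p.2 p'.2) := by
  simp only [frobInner, signInner, priorMatrix, Matrix.of_apply]
  rw [mul_comm (∑ i, _), Finset.sum_mul_sum, Finset.mul_sum, Fintype.sum_prod_type]
  refine Finset.sum_congr rfl fun l _ => ?_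
  rw [Finset.mul_sum]
  refine Finset.sum_congr rfl fun i _ => ?_
  linear_combination a ^ 2 * (sgn (p.2 l) * sgn (p'.2 l)) * (sgn (p.1 i) * sgn (p'.1 i)) *
    sgn_mul_self (H i l)

theorem frobSq_priorMatrix (a : ℝ) (H : Fin d → Fin d → Bool)
    (p : (Fin d → Bool) × (Fin d → Bool)) : frobSq (priorMatrix a H p) = a ^ 2 * d ^ 2 := by
  simp only [frobSq, priorMatrix, Matrix.of_apply, mul_pow, sgn_sq]
  simp; ring

/-- The lower bound for a prior with Frobenius norm `a * d`. -/
theorem le_testRisk_of_prior {N : NormKind} {ρ a τ ε : ℝ} {H : Fin d → Fin d → Bool}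
    (hn : 1 ≤ n) (hd : 1 ≤ d)
    (hH : ∀ p, priorMatrix a H p ∈ alternative N d k ρ) (hε : 0 < ε) (hτ : τ ≤ 1 / 8)
    (hτε : Real.exp (5 * τ ^ 2) ≤ 1 + ε ^ 2)
    (ha : a ^ 2 * d ^ 2 ≤ τ * min ((d : ℝ) / n) (1 / √(n : ℝ)))
    {A : Set (Observation n d)} (hA : MeasurableSet A) :
    ENNReal.ofReal (1 - ε) ≤ testRisk N k ρ A := by
  have hn1 : (1 : ℝ) ≤ n := by exact_mod_cast hn
  have hn0 : (0 : ℝ) < n := by linarith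
  have hd0 : (0 : ℝ) < d := by exact_mod_cast hd
  have hsn : 0 < √(n : ℝ) := Real.sqrt_pos.2 hn0
  have hsn1 : 1 ≤ √(n : ℝ) := Real.one_le_sqrt.2 hn1
  have hmin : 0 < min ((d : ℝ) / n) (1 / √(n : ℝ)) := by positivity
  have hτ0 : 0 ≤ τ := by
    by_contra! h
    have := mul_neg_of_neg_of_pos h hmin
    nlinarith [mul_nonneg (sq_nonneg a) (sq_nonneg (d : ℝ))]
  set s := a ^ 2 * (d : ℝ) ^ 2 with hs
  have hs0 : 0 ≤ s := by positivity
  have hsd : s ≤ τ * (d / n) := ha.trans (by gcongr; exact min_le_left _ _)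
  have hss : s * √(n : ℝ) ≤ τ := by
    have : s ≤ τ * (1 / √(n : ℝ)) := ha.trans (by gcongr; exact min_le_right _ _)
    rwa [mul_one_div, le_div_iff₀ hsn] at this
  have hs8 : s ≤ 1 / 8 := by nlinarith
  have hns : n * s ^ 2 ≤ τ ^ 2 := by
    calc n * s ^ 2 = (s * √(n : ℝ)) ^ 2 := by rw [mul_pow s, Real.sq_sqrt hn0.le]; ring
      _ ≤ τ ^ 2 := by gcongr
  have hl : (d * (n * a ^ 2)) ^ 2 ≤ τ ^ 2 := by
    refine pow_le_pow_left₀ (by positivity) ?_ 2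
    have : d * (n * a ^ 2) = s * n / d := by rw [hs]; field_simp
    rw [this, div_le_iff₀ hd0]
    rwa [← mul_div_assoc, le_div_iff₀ hn0] at hsd
  have hl2 : τ ^ 2 ≤ 1 / 2 := by nlinarith
  have hm := fun p p' => likelihood_second_moment (n := n) hs8
    ((frobSq_priorMatrix a H p).trans hs.symm) ((frobSq_priorMatrix a H p').trans hs.symm)
  refine le_testRisk_of_second_moment hH hε (fun p p' => (hm p p').1) ?_ hA
  calc _ ≤ ∑ p : (Fin d → Bool) × (Fin d → Bool), ∑ p' : (Fin d → Bool) × (Fin d → Bool),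
        Real.exp (4 * τ ^ 2) * Real.exp (n * a ^ 2 * (signInner p.1 p'.1 * signInner p.2 p'.2)) := by
        refine Finset.sum_le_sum fun p _ => Finset.sum_le_sum fun p' _ => (hm p p').2.trans ?_
        rw [← Real.exp_add, frobInner_priorMatrix]
        refine Real.exp_le_exp.2 ?_
        linarith
    _ ≤ Real.exp (4 * τ ^ 2) * (((4 : ℝ) ^ d) ^ 2 * (√(1 - (d * (n * a ^ 2)) ^ 2))⁻¹) := by
        simp_rw [← Finset.mul_sum]
        gcongr
        exact sum_exp_signInner_mul_le (by linarith)
    _ ≤ Real.exp (4 * τ ^ 2) * (((4 : ℝ) ^ d) ^ 2 * Real.exp (τ ^ 2)) := by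
        gcongr
        refine (inv_sqrt_one_sub_le ?_).trans (Real.exp_le_exp.2 ?_)
        · rw [abs_of_nonneg (sq_nonneg _)]; linarith
        · nlinarith [sq_nonneg (d * (n * a ^ 2))]
    _ = Real.exp (5 * τ ^ 2) * ((4 : ℝ) ^ d) ^ 2 := by
        rw [mul_left_comm, ← Real.exp_add]; ring_nf
    _ ≤ _ := by
        have hcard : (Fintype.card ((Fin d → Bool) × (Fin d → Bool)) : ℝ) = 4 ^ d := by
          simp [← mul_pow]
        rw [hcard]; gcongr

end

/-! ### Sign patterns with large nuclear norm -/

noncomputable section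

variable {n d k : ℕ}

theorem trace_mul_self_eq_sum_eigenvalues_sq {A : Matrix (Fin d) (Fin d) ℝ} (hA : A.IsHermitian) :
    (A * A).trace = ∑ j, hA.eigenvalues j ^ 2 := by
  conv_lhs => rw [hA.spectral_theorem, ← map_mul, Unitary.conjStarAlgAut_apply,
    Matrix.trace_mul_cycle, Unitary.coe_star_mul_self, one_mul, Matrix.diagonal_mul_diagonal]
  simp [Matrix.trace_diagonal, sq]

/-- Interpolation between the Schatten norms of exponents `1`, `2` and `4`. -/
theorem frobSq_pow_three_le (θ : Matrix (Fin d) (Fin d) ℝ) :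
    frobSq θ ^ 3 ≤ nuclearNorm θ ^ 2 * ((θ.transpose * θ) * (θ.transpose * θ)).trace := by
  set hA := Matrix.isHermitian_conjTranspose_mul_self θ
  have h0 (j : Fin d) : 0 ≤ hA.eigenvalues j :=
    (Matrix.posSemidef_conjTranspose_mul_self θ).eigenvalues_nonneg j
  have h2 : frobSq θ = ∑ j, √(hA.eigenvalues j) ^ 2 := by
    rw [← trace_transpose_mul_self, ← Matrix.conjTranspose_eq_transpose_of_trivial,
      hA.trace_eq_sum_eigenvalues]
    exact Finset.sum_congr rfl fun j _ => (Real.sq_sqrt (h0 j)).symm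
  have h4 : ((θ.transpose * θ) * (θ.transpose * θ)).trace = ∑ j, √(hA.eigenvalues j) ^ 4 := by
    rw [← Matrix.conjTranspose_eq_transpose_of_trivial, trace_mul_self_eq_sum_eigenvalues_sq hA]
    refine Finset.sum_congr rfl fun j _ => ?_
    rw [show √(hA.eigenvalues j) ^ 4 = (√(hA.eigenvalues j) ^ 2) ^ 2 by ring, Real.sq_sqrt (h0 j)]
  rw [h2, h4, nuclearNorm]
  have hσ : ∀ j, 0 ≤ √(hA.eigenvalues j) := fun j => Real.sqrt_nonneg _
  set σ : Fin d → ℝ := fun j => √(hA.eigenvalues j)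
  change (∑ j, σ j ^ 2) ^ 3 ≤ (∑ j, σ j) ^ 2 * ∑ j, σ j ^ 4
  have c1 : (∑ j, σ j ^ 2) ^ 2 ≤ (∑ j, σ j) * ∑ j, σ j ^ 3 :=
    Finset.sum_sq_le_sum_mul_sum_of_sq_le_mul _ (fun j _ => hσ j) (fun j _ => by
      have := hσ j; positivity) fun j _ => le_of_eq (by ring)
  have c2 : (∑ j, σ j ^ 3) ^ 2 ≤ (∑ j, σ j ^ 2) * ∑ j, σ j ^ 4 :=
    Finset.sum_sq_le_sum_mul_sum_of_sq_le_mul _ (fun j _ => sq_nonneg _) (fun j _ => by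
      positivity) fun j _ => le_of_eq (by ring)
  have s2 : 0 ≤ ∑ j, σ j ^ 2 := Finset.sum_nonneg fun j _ => sq_nonneg _
  have s4 : 0 ≤ ∑ j, σ j ^ 4 := Finset.sum_nonneg fun j _ => by positivity
  rcases s2.eq_or_lt with h | h
  · rw [← h, zero_pow three_ne_zero]; positivity
  · refine le_of_mul_le_mul_right ?_ h
    calc (∑ j, σ j ^ 2) ^ 3 * ∑ j, σ j ^ 2 = ((∑ j, σ j ^ 2) ^ 2) ^ 2 := by ring
      _ ≤ ((∑ j, σ j) * ∑ j, σ j ^ 3) ^ 2 := by gcongr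
      _ = (∑ j, σ j) ^ 2 * (∑ j, σ j ^ 3) ^ 2 := by ring
      _ ≤ (∑ j, σ j) ^ 2 * ((∑ j, σ j ^ 2) * ∑ j, σ j ^ 4) := by gcongr
      _ = _ := by ring

/-- A quadratic form takes a value at most its average, the trace, on the sign vectors. -/
theorem exists_sign_quadratic_le (G : Fin k → Fin k → ℝ) :
    ∃ c : Fin k → Bool, ∑ j, ∑ l, sgn (c j) * sgn (c l) * G j l ≤ ∑ j, G j j := by
  induction k with
  | zero => exact ⟨fun _ => true, by simp⟩
  | succ k ih =>
    obtain ⟨c, hc⟩ := ih fun j l => G j.succ l.succ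
    set X : ℝ := ∑ j : Fin k, sgn (c j) * (G j.succ 0 + G 0 j.succ) with hX
    obtain ⟨b, hb⟩ : ∃ b, sgn b * X ≤ 0 := by
      rcases le_total X 0 with h | h
      · exact ⟨true, by simpa [sgn] using h⟩
      · exact ⟨false, by simpa [sgn] using h⟩
    refine ⟨Fin.cons b c, ?_⟩
    simp only [Fin.sum_univ_succ, Fin.cons_zero, Fin.cons_succ, sgn_mul_self, one_mul]
    rw [Finset.sum_add_distrib]
    have e : sgn b * X = ∑ j : Fin k, sgn b * sgn (c j) * G 0 j.succ
        + ∑ j : Fin k, sgn (c j) * sgn b * G j.succ 0 := by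
      rw [hX, Finset.mul_sum, ← Finset.sum_add_distrib]
      exact Finset.sum_congr rfl fun j _ => by ring
    linarith

/-- There are `k` sign vectors of length `d` whose Gram matrix has small
Frobenius norm; they are built by adding one column at a time. -/
theorem exists_sign_vectors (k d : ℕ) : ∃ W : Fin k → Fin d → Bool,
    ∑ j, ∑ l, signInner (W j) (W l) ^ 2 ≤ (k : ℝ) * d ^ 2 + k ^ 2 * d := by
  induction d with
  | zero => exact ⟨fun _ _ => true, by simp [signInner]⟩
  | succ d ih =>
    obtain ⟨W, hW⟩ := ih
    obtain ⟨c, hc⟩ := exists_sign_quadratic_le fun j l => signInner (W j) (W l)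
    refine ⟨fun j => Fin.cons (c j) (W j), ?_⟩
    have hdiag (j : Fin k) : signInner (W j) (W j) = d := by simp [signInner, sgn_mul_self]
    simp only [hdiag, Finset.sum_const, Finset.card_univ, Fintype.card_fin, nsmul_eq_mul] at hc
    have e (j l : Fin k) : signInner (Fin.cons (c j) (W j) : Fin (d + 1) → Bool)
        (Fin.cons (c l) (W l)) ^ 2
        = 1 + 2 * (sgn (c j) * sgn (c l) * signInner (W j) (W l)) + signInner (W j) (W l) ^ 2 := by
      have : signInner (Fin.cons (c j) (W j) : Fin (d + 1) → Bool) (Fin.cons (c l) (W l))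
          = sgn (c j) * sgn (c l) + signInner (W j) (W l) := by
        simp [signInner, Fin.sum_univ_succ]
      rw [this]
      linear_combination sgn (c l) * sgn (c l) * sgn_mul_self (c j) + sgn_mul_self (c l)
    simp_rw [e, Finset.sum_add_distrib, ← Finset.mul_sum]
    simp only [Finset.sum_const, Finset.card_univ, Fintype.card_fin, nsmul_eq_mul, mul_one]
    push_cast
    nlinarith

/-- Each residue class modulo `k` has at most `d / k + 1 ≤ 2 d / k` elements below `d`. -/
theorem sum_mod_le (hk : 1 ≤ k) (hkd : k ≤ d) {F : Fin k → ℝ} (hF : ∀ j, 0 ≤ F j) :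
    ∑ i : Fin d, F ⟨i % k, Nat.mod_lt _ hk⟩ ≤ 2 * d / k * ∑ j, F j := by
  have hk0 : (0 : ℝ) < k := by exact_mod_cast hk
  rw [← Finset.sum_fiberwise_of_maps_to
    (g := fun i : Fin d => (⟨i % k, Nat.mod_lt _ hk⟩ : Fin k)) (fun _ _ => Finset.mem_univ _),
    Finset.mul_sum]
  refine Finset.sum_le_sum fun j _ => ?_
  have h1 : ((Finset.univ.filter fun i : Fin d => (⟨i % k, Nat.mod_lt _ hk⟩ : Fin k) = j).card)
      ≤ d / k + 1 := by
    rw [← Finset.card_range (d / k + 1)]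
    refine Finset.card_le_card_of_injOn (fun i : Fin d => (i : ℕ) / k) (fun i _ => ?_) ?_
    · simp only [Finset.coe_range, Set.mem_Iio]
      exact Nat.lt_succ_of_le (Nat.div_le_div_right i.2.le)
    · intro a ha b hb hab
      simp only [Finset.coe_filter, Finset.mem_univ, true_and, Set.mem_ofPred_eq] at ha hb
      have hm : (a : ℕ) % k = b % k := congrArg Fin.val (ha.trans hb.symm)
      have hab' : (a : ℕ) / k = b / k := hab
      ext
      rw [← Nat.div_add_mod (a : ℕ) k, ← Nat.div_add_mod (b : ℕ) k, hm, hab']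
  have h2 : ((d / k + 1 : ℕ) : ℝ) ≤ 2 * d / k := by
    rw [le_div_iff₀ hk0]
    have : (d / k + 1) * k ≤ 2 * d := by
      rw [add_mul, one_mul, two_mul]
      exact add_le_add (Nat.div_mul_le_self d k) hkd
    exact_mod_cast this
  rw [Finset.sum_congr rfl fun i hi => by rw [(Finset.mem_filter.1 hi).2], Finset.sum_const,
    nsmul_eq_mul]
  exact mul_le_mul_of_nonneg_right (le_trans (by exact_mod_cast h1) h2) (hF j)

/-- The prior pattern whose rows are the vectors `W 0, …, W (k - 1)` repeated periodically. -/
def periodicPattern (hk : 1 ≤ k) (W : Fin k → Fin d → Bool) : Fin d → Fin d → Bool :=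
  fun i => W ⟨i % k, Nat.mod_lt _ hk⟩

theorem rank_priorMatrix_le (hk : 1 ≤ k) (W : Fin k → Fin d → Bool) (a : ℝ)
    (p : (Fin d → Bool) × (Fin d → Bool)) :
    (priorMatrix a (periodicPattern hk W) p).rank ≤ k := by
  have e : priorMatrix a (periodicPattern hk W) p
      = (Matrix.of fun (i : Fin d) (j : Fin k) =>
          if j = ⟨i % k, Nat.mod_lt _ hk⟩ then a * sgn (p.1 i) else 0)
        * (Matrix.of fun (j : Fin k) (l : Fin d) => sgn (W j l) * sgn (p.2 l)) := by
    ext i l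
    simp [priorMatrix, periodicPattern, Matrix.mul_apply, mul_assoc]
  rw [e]
  refine (Matrix.rank_mul_le_left _ _).trans ?_
  simpa using Matrix.rank_le_width
    (Matrix.of fun (i : Fin d) (j : Fin k) =>
          if j = ⟨i % k, Nat.mod_lt _ hk⟩ then a * sgn (p.1 i) else 0)

/-- The sign flips `p` do not change this trace. -/
theorem trace_priorMatrix (a : ℝ) (H : Fin d → Fin d → Bool)
    (p : (Fin d → Bool) × (Fin d → Bool)) :
    (((priorMatrix a H p).transpose * priorMatrix a H p) *
      ((priorMatrix a H p).transpose * priorMatrix a H p)).trace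
      = a ^ 4 * ∑ i, ∑ j, signInner (H i) (H j) ^ 2 := by
  set θ := priorMatrix a H p with hθ
  have e : ((θ.transpose * θ) * (θ.transpose * θ)).trace
      = ((θ * θ.transpose) * (θ * θ.transpose)).trace := by
    rw [Matrix.mul_assoc, Matrix.trace_mul_comm]
    simp only [Matrix.mul_assoc]
  have e2 (i j : Fin d) : (θ * θ.transpose) i j
      = a ^ 2 * (sgn (p.1 i) * sgn (p.1 j)) * signInner (H i) (H j) := by
    simp only [Matrix.mul_apply, Matrix.transpose_apply, hθ, priorMatrix, Matrix.of_apply,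
      signInner, Finset.mul_sum]
    refine Finset.sum_congr rfl fun l _ => ?_
    linear_combination a ^ 2 * (sgn (p.1 i) * sgn (p.1 j)) * (sgn (H i l) * sgn (H j l)) *
      sgn_mul_self (p.2 l)
  have hc (x y : Fin d → Bool) : signInner x y = signInner y x :=
    Finset.sum_congr rfl fun _ _ => mul_comm _ _
  rw [e, Matrix.trace, Finset.mul_sum]
  refine Finset.sum_congr rfl fun i _ => ?_
  rw [Matrix.diag, Matrix.mul_apply, Finset.mul_sum]
  refine Finset.sum_congr rfl fun j _ => ?_
  rw [e2, e2, hc (H j) (H i)]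
  linear_combination a ^ 4 * signInner (H i) (H j) ^ 2 * (sgn (p.1 i) * sgn (p.1 i)) *
    sgn_mul_self (p.1 j) + a ^ 4 * signInner (H i) (H j) ^ 2 * sgn_mul_self (p.1 i)

/-- A prior all of whose matrices have the largest possible nuclear norm, up to a constant, for
their rank and Frobenius norm. -/
theorem exists_pattern (hk : 1 ≤ k) (hkd : k ≤ d) : ∃ H : Fin d → Fin d → Bool,
    ∀ (a : ℝ) (p : (Fin d → Bool) × (Fin d → Bool)),
      (priorMatrix a H p).rank ≤ k ∧
      a ^ 2 * d ^ 2 * k / 8 ≤ nuclearNorm (priorMatrix a H p) ^ 2 := by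
  obtain ⟨W, hW⟩ := exists_sign_vectors k d
  refine ⟨periodicPattern hk W, fun a p => ⟨rank_priorMatrix_le hk W a p, ?_⟩⟩
  have hk0 : (0 : ℝ) < k := by exact_mod_cast hk
  have hd0 : (0 : ℝ) < d := by exact_mod_cast hk.trans hkd
  have hkd' : (k : ℝ) ≤ d := by exact_mod_cast hkd
  have h1 : ∑ i, ∑ j, signInner (periodicPattern hk W i) (periodicPattern hk W j) ^ 2
      ≤ 8 * d ^ 4 / k := by
    calc _ ≤ 2 * d / k * ∑ j, ∑ i, signInner (W j) (periodicPattern hk W i) ^ 2 :=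
          sum_mod_le hk hkd (F := fun j => ∑ i, signInner (W j) (periodicPattern hk W i) ^ 2)
            fun j => Finset.sum_nonneg fun i _ => sq_nonneg _
      _ ≤ 2 * d / k * ∑ j, 2 * d / k * ∑ l, signInner (W j) (W l) ^ 2 := by
          gcongr with j
          exact sum_mod_le hk hkd (F := fun l => signInner (W j) (W l) ^ 2) fun l => sq_nonneg _
      _ = 4 * d ^ 2 / k ^ 2 * ∑ j, ∑ l, signInner (W j) (W l) ^ 2 := by
          rw [← Finset.mul_sum]; field_simp; ring
      _ ≤ 4 * d ^ 2 / k ^ 2 * (2 * k * d ^ 2) := by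
          gcongr
          refine hW.trans ?_
          nlinarith [mul_le_mul_of_nonneg_left hkd' (mul_pos hk0 hd0).le]
      _ = _ := by field_simp; norm_num
  have h2 := frobSq_pow_three_le (priorMatrix a (periodicPattern hk W) p)
  rw [trace_priorMatrix, frobSq_priorMatrix] at h2
  set ν := nuclearNorm (priorMatrix a (periodicPattern hk W) p)
  rcases eq_or_ne a 0 with rfl | ha
  · simpa using sq_nonneg ν
  have h3 : (a ^ 2 * (d : ℝ) ^ 2) ^ 3 ≤ ν ^ 2 * (a ^ 4 * (8 * d ^ 4 / k)) :=
    h2.trans (by gcongr)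
  have h4 : 0 < a ^ 4 * (8 * (d : ℝ) ^ 4 / k) := by positivity
  refine le_of_mul_le_mul_right (le_trans (le_of_eq ?_) h3) h4
  field_simp

end

/-! ### The lower bound -/

noncomputable section

variable {n d k : ℕ}

/-- Below a small multiple of the detection boundary every test has total error at least `1 - ε`. -/
theorem exists_le_minimaxRisk (N : NormKind) {ε : ℝ} (hε : 0 < ε) : ∃ η : ℝ, 0 < η ∧
    ∀ n d k : ℕ, 1 ≤ n → 1 ≤ k → k ≤ d → ∀ ρ : ℝ, 0 < ρ → ρ ≤ η * N.rate n d k →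
      ENNReal.ofReal (1 - ε) ≤ minimaxRisk N n d k ρ := by
  have hlog : 0 < Real.log (1 + ε ^ 2) := Real.log_pos (by nlinarith [sq_pos_of_pos hε])
  set τ : ℝ := min (1 / 8) (√(Real.log (1 + ε ^ 2) / 5)) with hτ
  have hτ0 : 0 < τ := by
    refine lt_min (by norm_num) (Real.sqrt_pos.2 (by positivity))
  have hτε : Real.exp (5 * τ ^ 2) ≤ 1 + ε ^ 2 := by
    rw [← Real.le_log_iff_exp_le (by positivity)]
    have : τ ^ 2 ≤ Real.log (1 + ε ^ 2) / 5 :=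
      (pow_le_pow_left₀ hτ0.le (min_le_right _ _) 2).trans_eq (Real.sq_sqrt (by positivity))
    linarith
  refine ⟨√(τ / 8), Real.sqrt_pos.2 (by positivity), fun n d k hn hk hkd ρ hρ hle => ?_⟩
  have hd : 1 ≤ d := hk.trans hkd
  have hd0 : (0 : ℝ) < d := by exact_mod_cast hd
  have hk0 : (0 : ℝ) < k := by exact_mod_cast hk
  have hr := rate_frobenius_nonneg n d k
  have hη : √(τ / 8) ^ 2 = τ / 8 := Real.sq_sqrt (by positivity)
  have hmin : 0 ≤ min ((d : ℝ) / n) (1 / √(n : ℝ)) := by positivity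
  obtain ⟨H, hH⟩ := exists_pattern hk hkd
  refine le_iInf₂ fun A hA => ?_
  cases N with
  | frobenius =>
    have h2 := pow_le_pow_left₀ hρ.le hle 2
    rw [mul_pow, hη, rate_frobenius_sq] at h2
    have e : (ρ / d) ^ 2 * (d : ℝ) ^ 2 = ρ ^ 2 := by field_simp
    refine le_testRisk_of_prior (a := ρ / d) (H := H) hn hd (fun p => ⟨(hH _ p).1, ?_⟩) hε
      (min_le_left _ _) hτε ?_ hA
    · change ρ ≤ frobeniusNorm _
      refine le_of_sq_le_sq ?_ (Real.sqrt_nonneg _)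
      rw [frobeniusNorm_sq, frobSq_priorMatrix, e]
    · rw [e]; nlinarith [mul_nonneg hτ0.le hmin]
  | nuclear =>
    rw [rate_nuclear_eq] at hle
    have h2 := pow_le_pow_left₀ hρ.le hle 2
    rw [mul_pow, hη, mul_pow, Real.sq_sqrt hk0.le, rate_frobenius_sq] at h2
    have e : (√8 * ρ / (√(k : ℝ) * d)) ^ 2 * (d : ℝ) ^ 2 = 8 * ρ ^ 2 / k := by
      rw [div_pow, mul_pow, mul_pow, Real.sq_sqrt hk0.le, Real.sq_sqrt (by norm_num)]
      field_simp
    refine le_testRisk_of_prior (a := √8 * ρ / (√(k : ℝ) * d)) (H := H) hn hd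
      (fun p => ⟨(hH _ p).1, ?_⟩) hε (min_le_left _ _) hτε ?_ hA
    · change ρ ≤ nuclearNorm _
      refine le_of_sq_le_sq ?_ (Finset.sum_nonneg fun j _ => Real.sqrt_nonneg _)
      refine le_trans (le_of_eq ?_) (hH _ p).2
      rw [e]; field_simp
    · rw [e, div_le_iff₀ hk0]; linarith

theorem eventually_le_minimaxRisk (N : NormKind) {k : ℕ → ℕ → ℕ} {ρ : ℕ → ℕ → ℝ}
    (h : ∀ n d : ℕ, 1 ≤ n → 1 ≤ d → 1 ≤ k n d ∧ k n d ≤ d ∧ 0 < ρ n d)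
    (hρ : (fun p : ℕ × ℕ => ρ p.1 p.2)
      =o[atTop ×ˢ atTop] fun p : ℕ × ℕ => N.rate p.1 p.2 (k p.1 p.2)) {ε : ℝ} (hε : 0 < ε) :
    ∀ᶠ p : ℕ × ℕ in atTop ×ˢ atTop,
      ENNReal.ofReal (1 - ε) ≤ minimaxRisk N p.1 p.2 (k p.1 p.2) (ρ p.1 p.2) := by
  obtain ⟨η, hη, H⟩ := exists_le_minimaxRisk N hε
  have h1 : ∀ᶠ p : ℕ × ℕ in atTop ×ˢ atTop, 1 ≤ p.1 ∧ 1 ≤ p.2 :=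
    (eventually_ge_atTop 1).prod_mk (eventually_ge_atTop 1)
  filter_upwards [hρ.def hη, h1] with p hp ⟨hn, hd⟩
  obtain ⟨a, b, c⟩ := h p.1 p.2 hn hd
  have hr : 0 ≤ N.rate p.1 p.2 (k p.1 p.2) := by
    cases N
    · exact rate_frobenius_nonneg _ _ _
    · rw [rate_nuclear_eq]
      exact mul_nonneg (Real.sqrt_nonneg _) (rate_frobenius_nonneg _ _ _)
  rw [Real.norm_of_nonneg c.le, Real.norm_of_nonneg hr] at hp
  exact H _ _ _ hn a b _ c hp

end

end TraceRegression

theorem theorem1 (N : TraceRegression.NormKind) :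
    -- Part 1: the explicit tests achieve total error `α` above the boundary
    (∀ α : ℝ, 0 < α → ∃ (c D : ℝ) (n₀ : ℕ), 0 < D ∧
      ∀ n d k : ℕ, n₀ ≤ n → 1 ≤ k → k ≤ d → ∀ ρ : ℝ, D * N.rate n d k ≤ ρ →
        MeasurableSet (TraceRegression.explicitTest n d c) ∧
        TraceRegression.testRisk N k ρ (TraceRegression.explicitTest n d c)
          ≤ ENNReal.ofReal α) ∧
    -- Part 2: the lower bound below the boundary
    (∀ (k : ℕ → ℕ → ℕ) (ρ : ℕ → ℕ → ℝ),
      (∀ n d : ℕ, 1 ≤ n → 1 ≤ d → 1 ≤ k n d ∧ k n d ≤ d ∧ 0 < ρ n d) →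
      (fun p : ℕ × ℕ => ρ p.1 p.2)
        =o[atTop ×ˢ atTop] (fun p : ℕ × ℕ => N.rate p.1 p.2 (k p.1 p.2)) →
      (fun p : ℕ × ℕ => (k p.1 p.2 : ℝ)) =o[atTop ×ˢ atTop] (fun p : ℕ × ℕ => (p.2 : ℝ)) →
      (¬ ∀ α : ℝ, 0 < α →
          ∃ A : (n d : ℕ) → Set (TraceRegression.Observation n d),
            (∀ n d, MeasurableSet (A n d)) ∧
            ∀ᶠ p : ℕ × ℕ in atTop ×ˢ atTop,
              TraceRegression.testRisk N (k p.1 p.2) (ρ p.1 p.2) (A p.1 p.2)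
                ≤ ENNReal.ofReal α) ∧
      1 ≤ liminf (fun p : ℕ × ℕ =>
            TraceRegression.minimaxRisk N p.1 p.2 (k p.1 p.2) (ρ p.1 p.2))
          (atTop ×ˢ atTop)) := by
  refine ⟨fun α hα => TraceRegression.exists_explicitTest_risk_le N hα,
    fun k ρ h hρ _ => ⟨fun H => ?_, ?_⟩⟩
  · obtain ⟨A, hA, hrisk⟩ := H (1 / 4) (by norm_num)
    obtain ⟨p, h1, h2⟩ := (hrisk.and (TraceRegression.eventually_le_minimaxRisk N h hρ
      (show (0 : ℝ) < 1 / 2 by norm_num))).exists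
    have h3 := (h2.trans (iInf₂_le (A p.1 p.2) (hA p.1 p.2))).trans h1
    rw [ENNReal.ofReal_le_ofReal_iff (by norm_num)] at h3
    norm_num at h3
  · have hlim : Tendsto (fun ε : ℝ => ENNReal.ofReal (1 - ε)) (nhdsWithin 0 (Set.Ioi 0))
        (nhds 1) := by
      have hc : Continuous fun ε : ℝ => ENNReal.ofReal (1 - ε) :=
        ENNReal.continuous_ofReal.comp (by fun_prop)
      simpa using (hc.tendsto 0).mono_left nhdsWithin_le_nhds
    refine le_of_tendsto hlim ?_
    filter_upwards [self_mem_nhdsWithin] with ε hε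
    exact le_liminf_of_le (h := TraceRegression.eventually_le_minimaxRisk N h hρ hε)
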